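/- Let $q \ge 2$ be an integer. For a finite simple undirected graph $G$ on the vertex set $[n]$, an index code of length $\ell$ over $[q]$ for $G$ is a map $E : [q]^n \to [q]^\ell$ such that for every vertex $i$ there is a decoding function $g_i$ with $g_i(E(x), x_{N_G(i)}) = x_i$ for all $x \in [q]^n$, where $x_{N_G(i)}$ is the restriction of $x$ to the entries indexed by the neighbors of $i$. Let $\mathrm{Ind}_q(G)$ be the smallest $\ell$ for which such a code exists. The problem $\mathsf{Dual\ Index\ Coding}_q$ asks, given a graph $G$ on $n$ vertices and an integer $k \ge 0$ (the parameter), whether $\mathrm{Ind}_q(G) \le n-k$. Theorem. For every integer $q \ge 2$ there is a kernelization algorithm for $\mathsf{Dual\ Index\ Coding}_q$, that is, an algorithm which on input $(G,k)$ runs in time polynomial in the size of the input (the $n^2$ bits of the adjacency matrix of $G$ and the bits of the binary representation of $k$; time is counted in steps of a random access machine with unit-cost addition and subtraction) and returns an instance $(G',k')$, whose size and parameter are bounded by a computable function of $k$, such that $\mathrm{Ind}_q(G) \le n-k$ if and only if $\mathrm{Ind}_q(G') \le n'-k'$, where $n'$ is the number of vertices of $G'$. Moreover, for every input, $n' \le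 \max(3k'-3,0)$ and $k' \le k$. -/

import Mathlib

/-! ### A random access machine with a step count -/

namespace RAM

/-- Memory of the machine: scalar registers and arrays of registers, all holding natural numbers.
A program mentions only finitely many registers and finitely many arrays. -/
@[ext]
structure State where
  /-- the content of the `x`-th scalar register -/
  var : ℕ → ℕ
  /-- the content of cell `i` of the `a`-th array -/
  arr : ℕ → ℕ → ℕ

/-- Arithmetic expressions: constants, registers, array cells (indirect addressing),
addition and truncated subtraction. There is deliberately no unit-cost multiplication, so after
`t` steps every number in memory has at most `O(t)` more bits than at the start, and the step
count below is polynomially related to the running time of a Turing machine. -/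
inductive Expr where
  | const (c : ℕ)
  | var (x : ℕ)
  | get (a : ℕ) (i : Expr)
  | add (e₁ e₂ : Expr)
  | sub (e₁ e₂ : Expr)

/-- The value of an expression in a given state of the memory. -/
def Expr.eval (s : State) : Expr → ℕ
  | .const c => c
  | .var x => s.var x
  | .get a i => s.arr a (i.eval s)
  | .add e₁ e₂ => e₁.eval s + e₂.eval s
  | .sub e₁ e₂ => e₁.eval s - e₂.eval s

/-- The number of steps spent on evaluating an expression: one for each of its nodes. -/
def Expr.cost : Expr → ℕ
  | .const _ => 1
  | .var _ => 1
  | .get _ i => i.cost + 1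
  | .add e₁ e₂ => e₁.cost + e₂.cost + 1
  | .sub e₁ e₂ => e₁.cost + e₂.cost + 1

/-- Programs. Tests regard a number as true when it is not `0`. -/
inductive Prog where
  /-- do nothing -/
  | skip
  /-- `x := e` -/
  | set (x : ℕ) (e : Expr)
  /-- `a[i] := e` -/
  | put (a : ℕ) (i e : Expr)
  /-- `p; r` -/
  | seq (p r : Prog)
  /-- `if e ≠ 0 then p else r` -/
  | ite (e : Expr) (p r : Prog)
  /-- `while e ≠ 0 do p` -/
  | loop (e : Expr) (p : Prog)

/-- `Run p s t s'`: started in the state `s`, the program `p` halts after exactly `t` steps,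
in the state `s'`. -/
inductive Run : Prog → State → ℕ → State → Prop where
  | skip (s : State) : Run .skip s 1 s
  | set (s : State) (x : ℕ) (e : Expr) :
      Run (.set x e) s (e.cost + 1) ⟨Function.update s.var x (e.eval s), s.arr⟩
  | put (s : State) (a : ℕ) (i e : Expr) :
      Run (.put a i e) s (i.cost + e.cost + 1)
        ⟨s.var, Function.update s.arr a (Function.update (s.arr a) (i.eval s) (e.eval s))⟩
  | seq {p r : Prog} {s s' s'' : State} {t t' : ℕ} :
      Run p s t s' → Run r s' t' s'' → Run (.seq p r) s (t + t') s''
  | iteTrue {e : Expr} {p r : Prog} {s s' : State} {t : ℕ} :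
      e.eval s ≠ 0 → Run p s t s' → Run (.ite e p r) s (e.cost + 1 + t) s'
  | iteFalse {e : Expr} {p r : Prog} {s s' : State} {t : ℕ} :
      e.eval s = 0 → Run r s t s' → Run (.ite e p r) s (e.cost + 1 + t) s'
  | loopDone {e : Expr} {p : Prog} {s : State} :
      e.eval s = 0 → Run (.loop e p) s (e.cost + 1) s
  | loopStep {e : Expr} {p : Prog} {s s' s'' : State} {t t' : ℕ} :
      e.eval s ≠ 0 → Run p s t s' → Run (.loop e p) s' t' s'' →
      Run (.loop e p) s (e.cost + 1 + t + t') s''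

end RAM

/-! ### Parameterized graph problems and kernelization -/

/-- An instance `(G, k)` of a parameterized graph problem: a (finite, simple, undirected) graph
on `n` vertices together with the parameter. -/
structure GraphInstance where
  /-- the number of vertices -/
  n : ℕ
  /-- the graph -/
  G : SimpleGraph (Fin n)
  /-- the parameter -/
  k : ℕ

namespace GraphInstance

/-- The size of an instance: the number of bits of the adjacency matrix of the graph and of the
binary representation of the parameter. -/
def size (I : GraphInstance) : ℕ := I.n ^ 2 + Nat.size I.k

open Classical in
/-- The state `s` contains the instance `I`: register `0` holds the number of vertices, register
`1` the parameter, and array `0` the adjacency matrix, row by row. -/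
def IsStoredIn (I : GraphInstance) (s : RAM.State) : Prop :=
  s.var 0 = I.n ∧ s.var 1 = I.k ∧
    ∀ i j : Fin I.n, s.arr 0 (i * I.n + j) = if I.G.Adj i j then 1 else 0

open Classical in
/-- The initial state on input `I`: the memory contains `I` in the format of `IsStoredIn`, and
`0` everywhere else. -/
noncomputable def initialState (I : GraphInstance) : RAM.State where
  var x := if x = 0 then I.n else if x = 1 then I.k else 0
  arr a m := if a = 0 ∧ ∃ i j : Fin I.n, I.G.Adj i j ∧ m = i * I.n + j then 1 else 0

end GraphInstance

/-- The map `f` on instances is computed by a single program in a number of steps that is bounded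
by a polynomial in the size of the input. -/
def IsPolyTime (f : GraphInstance → GraphInstance) : Prop :=
  ∃ (P : RAM.Prog) (T : Polynomial ℕ), ∀ I : GraphInstance,
    ∃ (t : ℕ) (s : RAM.State),
      RAM.Run P I.initialState t s ∧ (f I).IsStoredIn s ∧ t ≤ T.eval I.size

/-- `f` is (the input-output map of) a kernelization algorithm for the parameterized problem `L`:
it runs in polynomial time, it returns equivalent instances, and the size and the parameter of
its output are bounded by a computable function of the parameter of the input. -/
def IsKernelization (L : Set GraphInstance) (f : GraphInstance → GraphInstance) : Prop :=
  IsPolyTime f ∧ (∀ I, I ∈ L ↔ f I ∈ L) ∧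
    ∃ h : ℕ → ℕ, Computable h ∧ ∀ I, (f I).size ≤ h I.k ∧ (f I).k ≤ h I.k

/-! ### Index coding -/

/-- `E` is an index code of length `ℓ` over the alphabet `A` for the graph `G`: each vertex `i`
has a decoding function that recovers `x i` from the codeword `E x` and from the restriction of
`x` to the neighborhood of `i`. -/
def IsIndexCode {V A : Type*} (G : SimpleGraph V) {ℓ : ℕ} (E : (V → A) → (Fin ℓ → A)) : Prop :=
  ∀ i : V, ∃ g : (Fin ℓ → A) → (G.neighborSet i → A) → A,
    ∀ x : V → A, g (E x) (fun j => x j) = x i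

/-- `Ind_q(G)`: the smallest length of an index code for `G` over an alphabet of size `q`. -/
noncomputable def indexCodingLength (q : ℕ) {n : ℕ} (G : SimpleGraph (Fin n)) : ℕ :=
  sInf {ℓ : ℕ | ∃ E : (Fin n → Fin q) → (Fin ℓ → Fin q), IsIndexCode G E}

/-- The set over which the minimum is taken is not empty: the whole message can be sent. -/
theorem exists_isIndexCode (q : ℕ) {n : ℕ} (G : SimpleGraph (Fin n)) :
    ∃ E : (Fin n → Fin q) → (Fin n → Fin q), IsIndexCode G E :=
  ⟨id, fun i => ⟨fun c _ => c i, fun _ => rfl⟩⟩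

/-- The `Dual Index Coding_q` problem: decide whether `Ind_q(G) ≤ n - k` (in the integers). -/
def DualIndexCoding (q : ℕ) : Set GraphInstance :=
  {I | (indexCodingLength q I.G : ℤ) ≤ (I.n : ℤ) - (I.k : ℤ)}

/-! ### Index codes of graphs with a crown -/

/-! A crown is an independent set `C` whose neighborhood `T` is matched into `C` by `f`. Removing it
lowers `indexCodingLength` by exactly `|C|`. For the upper bound, each matched pair sends the sum of
its two symbols, and each endpoint knows the other summand; the unmatched vertices of `C` send their
own symbol (`exists_isIndexCode_of_pairing`). For the lower bound, set all symbols on `T` to zero: a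
codeword then reveals every symbol on `C`, so the codewords fall into `q ^ |C|` disjoint classes,
and a smallest class is a code for the rest (`exists_isIndexCode_comap`). This is pure counting, so
it covers nonlinear codes. As `n` drops by `|C| + |T|`, the parameter drops by `|T|`.

Crowns come from the bipartite double cover of the graph. Suppose the left set `S` has all its
neighbors in the right set `H`, with `H` matched into `S` and the complement of `S` matched into the
complement of `H` (a König cover certifying a maximum matching). Then `S \ H` is a crown with head
`H \ S`, and on the remaining `m` vertices the two matchings combine to an injective self-map along
edges (`indexCodingLength_of_matching`). Such a graph has a matching with at least `m / 3` edges
(`exists_pairing_of_injective`), each of which saves a symbol. So the answer is yes when `m ≥ 3k' -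
2`; otherwise the remaining graph is the kernel.

The sets `S` and `H` are found by an auction: unmatched left copies bid on their cheapest neighbors
and raise the prices by one. Pigeonhole yields a value `j` that is no price, and `H` consists of the
right copies above `j` (`AuctionInv.crown`). The program does not depend on `q`. -/

/-- A code is an index code as soon as it separates any two messages that agree on the
neighborhood of a vertex and differ at this vertex. -/
theorem isIndexCode_iff {V A : Type*} [Nonempty A] (G : SimpleGraph V) {ℓ : ℕ}
    (E : (V → A) → (Fin ℓ → A)) :
    IsIndexCode G E ↔ ∀ i x y, E x = E y → (∀ j, G.Adj i j → x j = y j) → x i = y i := by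
  constructor
  · intro h i x y hE hN
    obtain ⟨g, hg⟩ := h i
    rw [← hg x, ← hg y, hE]
    congr 1
    funext j
    exact hN j j.2
  · intro h i
    classical
    refine ⟨fun c z => if hx : ∃ x : V → A, E x = c ∧ (fun j : G.neighborSet i => x j) = z
      then hx.choose i else Classical.arbitrary A, fun x => ?_⟩
    have hx : ∃ y : V → A, E y = E x ∧
        (fun j : G.neighborSet i => y j) = fun j : G.neighborSet i => x j := ⟨x, rfl, rfl⟩
    simp only [dif_pos hx]
    exact h i _ _ hx.choose_spec.1 fun j hj => congrFun hx.choose_spec.2 ⟨j, hj⟩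

/-- An index code may take its codewords in any set that is small enough. -/
theorem exists_isIndexCode_of_separating {V M : Type*} {q ℓ : ℕ} [NeZero q] [Fintype M]
    (G : SimpleGraph V) (hM : Fintype.card M ≤ q ^ ℓ) (F : (V → Fin q) → M)
    (hF : ∀ i x y, F x = F y → (∀ j, G.Adj i j → x j = y j) → x i = y i) :
    ∃ E : (V → Fin q) → (Fin ℓ → Fin q), IsIndexCode G E := by
  obtain ⟨f⟩ : Nonempty (M ↪ (Fin ℓ → Fin q)) := by
    apply Function.Embedding.nonempty_of_card_le
    simpa using hM
  refine ⟨fun x => f (F x), (isIndexCode_iff _ _).2 fun i x y h => hF i x y (f.injective h)⟩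

/-- If `T` is matched into `W`, then one symbol for each element of `W` suffices to transmit the
symbols of `T ∪ W`. -/
theorem exists_isIndexCode_of_pairing {V V' : Type*} [Fintype V] [DecidableEq V] {q ℓ : ℕ}
    [NeZero q] (G : SimpleGraph V) (e : V' → V) (T W : Finset V) (f : V → V)
    (hcov : ∀ v, v ∈ T ∨ v ∈ W ∨ ∃ z, e z = v) (hfW : ∀ t ∈ T, f t ∈ W)
    (hf : Set.InjOn f T) (hadj : ∀ t ∈ T, G.Adj t (f t))
    (E' : (V' → Fin q) → (Fin ℓ → Fin q)) (hE' : IsIndexCode (G.comap e) E') :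
    ∃ E : (V → Fin q) → (Fin (W.card + ℓ) → Fin q), IsIndexCode G E := by
  -- By injectivity of `f` on `T`, the sum over a fiber has at most one term; it is empty when `w`
  -- has no partner.
  have hsum (x : V → Fin q) {t : V} (ht : t ∈ T) :
      ∑ s ∈ T with f s = f t, x s = x t := by
    rw [Finset.sum_eq_single t]
    · intro s hs hst
      rw [Finset.mem_filter] at hs
      exact absurd (hf hs.1 ht hs.2) hst
    · intro h
      exact absurd (by simp [ht]) h
  refine exists_isIndexCode_of_separating (M := (W → Fin q) × (Fin ℓ → Fin q)) G ?_
    (fun x => (fun w => x w + ∑ s ∈ T with f s = w, x s, E' fun z => x (e z))) ?_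
  · simp [pow_add]
  · intro i x y hF hN
    rw [Prod.mk.injEq] at hF
    rcases hcov i with hi | hi | ⟨z, rfl⟩
    · have h := congrFun hF.1 ⟨f i, hfW i hi⟩
      simp only [hsum _ hi] at h
      rw [hN _ (hadj i hi)] at h
      exact add_left_cancel h
    · have h := congrFun hF.1 ⟨i, hi⟩
      simp only at h
      have hs : ∑ s ∈ T with f s = i, x s = ∑ s ∈ T with f s = i, y s := by
        refine Finset.sum_congr rfl fun s hs => ?_
        rw [Finset.mem_filter] at hs
        exact hN s (hs.2 ▸ (hadj s hs.1).symm)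
      rw [hs] at h
      exact add_right_cancel h
    · exact (isIndexCode_iff _ _).1 hE' z _ _ hF.2 fun j hj => hN (e j) hj

/-- If all neighbors of `C` are outside of `C` and of the range of `e`, then each vertex of `C`
takes one symbol of an index code in addition to those for the range of `e`. -/
theorem exists_isIndexCode_comap {V V' : Type*} [Fintype V] [DecidableEq V] [Finite V']
    {q ℓ : ℕ} (hq : 2 ≤ q) (G : SimpleGraph V) (e : V' → V) (he : Function.Injective e)
    (C : Finset V) (heC : ∀ z, e z ∉ C) (hC : ∀ w ∈ C, ∀ v ∈ C, ¬ G.Adj w v)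
    (heN : ∀ w ∈ C, ∀ z, ¬ G.Adj w (e z))
    (E : (V → Fin q) → (Fin ℓ → Fin q)) (hE : IsIndexCode G E) :
    C.card ≤ ℓ ∧
      ∃ E' : (V' → Fin q) → (Fin (ℓ - C.card) → Fin q), IsIndexCode (G.comap e) E' := by
  classical
  have : NeZero q := ⟨by omega⟩
  have := Fintype.ofFinite V'
  rw [isIndexCode_iff] at hE
  -- Vertices outside of `C` and of the range of `e` get `0`; all neighbors of `C` are among them.
  let X (y : C → Fin q) (z : V' → Fin q) : V → Fin q := fun v =>
    if hv : v ∈ C then y ⟨v, hv⟩ else if hv : ∃ a, e a = v then z hv.choose else 0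
  have hXC (y z) (v : V) (hv : v ∈ C) : X y z v = y ⟨v, hv⟩ := by simp [X, hv]
  have hXe (y z a) : X y z (e a) = z a := by
    have h : ∃ b, e b = e a := ⟨a, rfl⟩
    simp only [X, heC, dif_neg, not_false_eq_true, dif_pos h]
    rw [he h.choose_spec]
  have hX0 (y z) (v : V) (hv : v ∉ C) (hv' : ¬ ∃ a, e a = v) : X y z v = 0 := by
    simp [X, hv, dif_neg hv']
  let I (y : C → Fin q) : Finset (Fin ℓ → Fin q) := Finset.univ.image fun z => E (X y z)
  -- The side information of every vertex of `C` is constantly zero, so a common codeword forces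
  -- equal symbols on `C`.
  have hdisj : ((Finset.univ : Finset (C → Fin q)) : Set (C → Fin q)).PairwiseDisjoint I := by
    intro y _ y' _ hne
    refine Finset.disjoint_left.2 fun c hc hc' => hne ?_
    obtain ⟨z, -, rfl⟩ := Finset.mem_image.1 hc
    obtain ⟨z', -, h⟩ := Finset.mem_image.1 hc'
    funext w
    rw [← hXC y z w w.2, ← hXC y' z' w w.2]
    refine hE w _ _ h.symm fun j hj => ?_
    have hj' : j ∉ C := fun h => hC w w.2 j h hj
    have hj'' : ¬ ∃ a, e a = j := by
      rintro ⟨a, rfl⟩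
      exact heN w w.2 a hj
    rw [hX0 _ _ j hj' hj'', hX0 _ _ j hj' hj'']
  -- A smallest class has at most the average size.
  obtain ⟨y, hy⟩ : ∃ y, q ^ C.card * (I y).card ≤ q ^ ℓ := by
    obtain ⟨y, -, hy⟩ := Finset.exists_min_image (Finset.univ : Finset (C → Fin q))
      (fun y => (I y).card) Finset.univ_nonempty
    refine ⟨y, ?_⟩
    calc q ^ C.card * (I y).card = ∑ _y' : C → Fin q, (I y).card := by simp
      _ ≤ ∑ y', (I y').card := Finset.sum_le_sum fun y' hy' => hy y' hy'
      _ = (Finset.univ.biUnion I).card := (Finset.card_biUnion hdisj).symm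
      _ ≤ q ^ ℓ := by simpa using Finset.card_le_univ (Finset.univ.biUnion I)
  have hpos : 0 < (I y).card := Finset.card_pos.2 ⟨E (X y 0), Finset.mem_image.2 ⟨0, by simp⟩⟩
  have hle : C.card ≤ ℓ := by
    refine (Nat.pow_le_pow_iff_right (a := q) (by omega)).1 (le_trans ?_ hy)
    exact Nat.le_mul_of_pos_right _ hpos
  refine ⟨hle, ?_⟩
  refine exists_isIndexCode_of_separating (M := I y) (G.comap e) ?_
    (fun z => ⟨E (X y z), Finset.mem_image.2 ⟨z, by simp⟩⟩) ?_
  · rw [Fintype.card_coe]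
    refine Nat.le_of_mul_le_mul_left ?_ (pow_pos (by omega : 0 < q) C.card)
    rwa [← pow_add, Nat.add_sub_cancel' hle]
  · intro i x x' h hN
    rw [← hXe y x i, ← hXe y x' i]
    refine hE (e i) _ _ (Subtype.ext_iff.1 h) fun j hj => ?_
    by_cases hjC : j ∈ C
    · rw [hXC _ _ j hjC, hXC _ _ j hjC]
    · by_cases hje : ∃ a, e a = j
      · obtain ⟨a, rfl⟩ := hje
        rw [hXe, hXe]
        exact hN a hj
      · rw [hX0 _ _ j hjC hje, hX0 _ _ j hjC hje]

/-- A graph with an injective self-map along its edges has a matching that covers two thirds of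
the vertices. -/
theorem exists_pairing_of_injective {V : Type*} [Fintype V] [DecidableEq V] (G : SimpleGraph V)
    (σ : V → V) (hσ : Function.Injective σ) (hadj : ∀ v, G.Adj v (σ v)) :
    ∃ (T : Finset V) (f : V → V), (∀ t ∈ T, f t ∉ T) ∧ Set.InjOn f T ∧
      (∀ t ∈ T, G.Adj t (f t)) ∧ Fintype.card V ≤ 3 * T.card := by
  let P (T : Finset V) : Prop :=
    ∃ f : V → V, (∀ t ∈ T, f t ∉ T) ∧ Set.InjOn f T ∧ ∀ t ∈ T, G.Adj t (f t)
  classical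
  obtain ⟨T, hT, hmax⟩ := Finset.exists_max_image (Finset.univ.filter P) Finset.card
    ⟨∅, Finset.mem_filter.2 ⟨Finset.mem_univ _, id, by simp⟩⟩
  obtain ⟨f, hfT, hf, hfadj⟩ := (Finset.mem_filter.1 hT).2
  refine ⟨T, f, hfT, hf, hfadj, ?_⟩
  -- Maximality of `T`: no choice of partners `g` works for a larger set `insert u T`.
  have hno (u : V) (hu : u ∉ T) (g : V → V) (h1 : ∀ t ∈ insert u T, g t ∉ insert u T)
      (h2 : ∀ a ∈ insert u T, ∀ b ∈ insert u T, g a = g b → a = b)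
      (h3 : ∀ t ∈ insert u T, G.Adj t (g t)) : False := by
    have := hmax _ (Finset.mem_filter.2 ⟨Finset.mem_univ (insert u T), g, h1,
      fun a ha b hb => h2 a ha b hb, h3⟩)
    rw [Finset.card_insert_of_notMem hu] at this
    omega
  replace hf : ∀ a ∈ T, ∀ b ∈ T, f a = f b → a = b := fun a ha b hb => hf ha hb
  set U : Finset V := Finset.univ \ (T ∪ T.image f) with hU
  have hUT (u : V) (hu : u ∈ U) : u ∉ T ∧ ∀ t ∈ T, f t ≠ u := by
    simpa [hU] using hu
  -- Otherwise the edge from `u` to `σ u` could be added to the matching.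
  have hσU (u : V) (hu : u ∈ U) : ∃ t ∈ T, σ u = t ∨ σ u = f t := by
    by_contra! hcon
    have hu' := hUT u hu
    have hadju := hadj u
    have hne := hadju.ne
    clear hmax hT hU hUT
    refine hno u hu'.1 (fun v => if v = u then σ u else f v) ?_ ?_ ?_ <;> clear hno <;>
      simp only [Finset.mem_insert] <;> grind
  choose! r hr using hσU
  have hinj : Set.InjOn r U := by
    intro u hu u' hu' hrr
    by_contra hne
    -- The path `u`, `t`, `f t`, `u'` is augmenting: match `t` to `u` and `u'` to `f t` instead.
    have key (u u' : V) (hu : u ∈ U) (hu' : u' ∈ U) (hne : u ≠ u') (t : V) (ht : t ∈ T)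
        (h : σ u = t) (h' : σ u' = f t) : False := by
      have h1 := hUT u hu
      have h2 := hUT u' hu'
      have h3 := (hadj u).symm
      have h4 := hadj u'
      rw [h] at h3
      rw [h'] at h4
      clear hmax hT hU hUT hr hrr hadj hσ h h'
      refine hno u' h2.1 (fun v => if v = u' then f t else if v = t then u else f v) ?_ ?_ ?_ <;>
        clear hno <;> simp only [Finset.mem_insert] <;> grind
    have h1 := hr u hu
    have h2 := hr u' hu'
    have h3 : σ u ≠ σ u' := fun h => hne (hσ h)
    rw [← hrr] at h2
    rcases h1 with ⟨ht, h1 | h1⟩ <;> rcases h2 with ⟨-, h2 | h2⟩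
    · exact h3 (h1.trans h2.symm)
    · exact key u u' hu hu' hne _ ht h1 h2
    · exact key u' u hu' hu (Ne.symm hne) _ ht h2 h1
    · exact h3 (h1.trans h2.symm)
  have hle : U.card ≤ T.card :=
    Finset.card_le_card_of_injOn r (fun u hu => (hr u hu).1) hinj
  have h1 : U.card + (T ∪ T.image f).card = Fintype.card V := by
    rw [hU, Finset.card_sdiff_add_card_eq_card (Finset.subset_univ _), Finset.card_univ]
  have h2 := Finset.card_union_le T (T.image f)
  have h3 : (T.image f).card ≤ T.card := Finset.card_image_le
  omega

theorem indexCodingLength_le {q n ℓ : ℕ} {G : SimpleGraph (Fin n)}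
    (h : ∃ E : (Fin n → Fin q) → (Fin ℓ → Fin q), IsIndexCode G E) :
    indexCodingLength q G ≤ ℓ :=
  Nat.sInf_le h

theorem exists_isIndexCode_indexCodingLength (q : ℕ) {n : ℕ} (G : SimpleGraph (Fin n)) :
    ∃ E : (Fin n → Fin q) → (Fin (indexCodingLength q G) → Fin q), IsIndexCode G E :=
  Nat.sInf_mem (s := {ℓ : ℕ | ∃ E : (Fin n → Fin q) → (Fin ℓ → Fin q), IsIndexCode G E})
    ⟨n, exists_isIndexCode q G⟩

/-- The crown reduction: an independent set `C` into which its neighborhood `T` is matched. -/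
theorem indexCodingLength_crown {q n m : ℕ} (hq : 2 ≤ q) (G : SimpleGraph (Fin n))
    (e : Fin m → Fin n) (he : Function.Injective e) (T C : Finset (Fin n)) (f : Fin n → Fin n)
    (hcov : ∀ v, v ∈ T ∨ v ∈ C ∨ ∃ z, e z = v) (heC : ∀ z, e z ∉ C) (heT : ∀ z, e z ∉ T)
    (hCT : Disjoint C T) (hN : ∀ w ∈ C, ∀ v, G.Adj w v → v ∈ T)
    (hfC : ∀ t ∈ T, f t ∈ C) (hf : Set.InjOn f T) (hadj : ∀ t ∈ T, G.Adj t (f t)) :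
    indexCodingLength q G = C.card + indexCodingLength q (G.comap e) := by
  have : NeZero q := ⟨by omega⟩
  apply le_antisymm
  · obtain ⟨E', hE'⟩ := exists_isIndexCode_indexCodingLength q (G.comap e)
    exact indexCodingLength_le
      (exists_isIndexCode_of_pairing G e T C f hcov hfC hf hadj E' hE')
  · obtain ⟨E, hE⟩ := exists_isIndexCode_indexCodingLength q G
    obtain ⟨hle, hE'⟩ := exists_isIndexCode_comap hq G e he C heC
      (fun w hw v hv h => Finset.disjoint_left.1 hCT hv (hN w hw v h))
      (fun w hw z h => heT z (hN w hw _ h)) E hE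
    have := indexCodingLength_le hE'
    omega

/-- A graph on `m` vertices with an injective self-map along its edges saves at least `m / 3`
symbols. -/
theorem three_mul_indexCodingLength_le {q m : ℕ} (hq : 2 ≤ q) (G : SimpleGraph (Fin m))
    (σ : Fin m → Fin m) (hσ : Function.Injective σ) (hadj : ∀ v, G.Adj v (σ v)) :
    3 * indexCodingLength q G ≤ 2 * m := by
  have : NeZero q := ⟨by omega⟩
  obtain ⟨T, f, hfT, hf, hfadj, hcard⟩ := exists_pairing_of_injective G σ hσ hadj
  -- Here `T` and its complement exhaust the graph, so the code for the rest has length `0` over no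
  -- vertices.
  have h := indexCodingLength_le (q := q) (ℓ := Tᶜ.card + 0) (G := G)
    (exists_isIndexCode_of_pairing G (Empty.elim : Empty → Fin m) T Tᶜ f
      (fun v => by simpa using em (v ∈ T)) (by simpa using hfT) hf hfadj
      (fun _ => Fin.elim0) (fun i => i.elim))
  rw [Finset.card_compl, Fintype.card_fin] at h
  rw [Fintype.card_fin] at hcard
  omega

/-- The crown that comes from a set `S` of vertices all whose neighbors are in `H`, where `f`
matches `H` into `S` and `g` matches the complement of `S` into the complement of `H`. -/
theorem indexCodingLength_of_matching {q n m : ℕ} (hq : 2 ≤ q) (G : SimpleGraph (Fin n))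
    (S H : Finset (Fin n)) (f g : Fin n → Fin n) (hSH : ∀ u ∈ S, ∀ v, G.Adj u v → v ∈ H)
    (hfS : ∀ v ∈ H, f v ∈ S) (hfadj : ∀ v ∈ H, G.Adj v (f v)) (hf : Set.InjOn f H)
    (hgH : ∀ u ∉ S, g u ∉ H) (hgadj : ∀ u ∉ S, G.Adj u (g u))
    (hg : ∀ u ∉ S, ∀ v ∉ S, g u = g v → u = v)
    (e : Fin m → Fin n) (he : Function.Injective e) (heSH : ∀ z, e z ∈ S ↔ e z ∈ H)
    (hcov : ∀ v, (v ∈ S ↔ v ∈ H) → ∃ z, e z = v) :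
    indexCodingLength q G = (S \ H).card + indexCodingLength q (G.comap e) ∧
      3 * indexCodingLength q (G.comap e) ≤ 2 * m ∧ (S \ H).card + (H \ S).card + m = n := by
  have hfH : ∀ v ∈ S ∩ H, f v ∈ S ∩ H := fun v hv => by
    rw [Finset.mem_inter] at hv ⊢
    exact ⟨hfS v hv.2, hSH v hv.1 _ (hfadj v hv.2)⟩
  -- An injective self-map of the finite set `S ∩ H` is onto. Hence `f` cannot send a vertex of `H \
  -- S` into `S ∩ H`, and must send it into `S \ H`.
  have hfsurj : ∀ w ∈ S ∩ H, ∃ v ∈ S ∩ H, f v = w := by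
    have h := Finset.eq_of_subset_of_card_le
      (Finset.image_subset_iff.2 hfH) (Finset.card_image_of_injOn (hf.mono (by simp))).ge
    intro w hw
    rw [← h] at hw
    exact Finset.mem_image.1 hw
  refine ⟨?_, ?_, ?_⟩
  · refine indexCodingLength_crown hq G e he (H \ S) (S \ H) f ?_ ?_ ?_ ?_ ?_ ?_ ?_ ?_
    · intro v
      have := hcov v
      simp only [Finset.mem_sdiff]
      tauto
    · intro z
      simp [heSH z]
    · intro z
      simp [heSH z]
    · rw [Finset.disjoint_left]
      intro v
      simp only [Finset.mem_sdiff]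
      tauto
    · intro w hw v hwv
      rw [Finset.mem_sdiff] at hw ⊢
      exact ⟨hSH w hw.1 v hwv, fun hv => hw.2 (hSH v hv w hwv.symm)⟩
    · intro t ht
      rw [Finset.mem_sdiff] at ht ⊢
      refine ⟨hfS t ht.1, fun h => ?_⟩
      obtain ⟨v, hv, hvt⟩ := hfsurj (f t) (Finset.mem_inter.2 ⟨hfS t ht.1, h⟩)
      rw [Finset.mem_inter] at hv
      exact ht.2 (hf hv.2 ht.1 hvt ▸ hv.1)
    · exact hf.mono (by simp)
    · exact fun t ht => hfadj t (Finset.mem_sdiff.1 ht).1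
  · classical
    have hgS : ∀ u, u ∉ S → u ∉ H → g u ∉ S := fun u hS hH h =>
      hH (hSH _ h u (hgadj u hS).symm)
    -- `f` preserves `S ∩ H` and `g` preserves the complement of `S ∪ H`; their images are separated
    -- by `S`, so `σ` is injective.
    have hσ : ∀ z, ∃ w, e w = if e z ∈ S then f (e z) else g (e z) := fun z => by
      apply hcov
      split_ifs with hz
      · have := hfH _ (Finset.mem_inter.2 ⟨hz, (heSH z).1 hz⟩)
        rw [Finset.mem_inter] at this
        tauto
      · have h1 := hgS _ hz (fun h => hz ((heSH z).2 h))
        have h2 := hgH _ hz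
        tauto
    choose σ hσ using hσ
    refine three_mul_indexCodingLength_le hq _ σ ?_ ?_
    · intro z w hzw
      have h := hσ z
      rw [hzw, hσ w] at h
      apply he
      split_ifs at h with hw hz hz
      · exact (hf ((heSH w).1 hw) ((heSH z).1 hz) h).symm
      · exact absurd (h ▸ hfS _ ((heSH w).1 hw)) (hgS _ hz fun h => hz ((heSH z).2 h))
      · exact absurd (h ▸ hfS _ ((heSH z).1 hz)) (hgS _ hw fun h => hw ((heSH w).2 h))
      · exact (hg _ hw _ hz h).symm
    · intro z
      rw [SimpleGraph.comap_adj, hσ z]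
      split_ifs with hz
      · exact hfadj _ ((heSH z).1 hz)
      · exact hgadj _ hz
  · have h1 : (Finset.univ.image e).card = m := by
      rw [Finset.card_image_of_injective _ he, Finset.card_fin]
    have h2 : Finset.univ.image e = ((S \ H) ∪ (H \ S))ᶜ := by
      ext v
      simp only [Finset.mem_image, Finset.mem_univ, true_and, Finset.mem_compl, Finset.mem_union,
        Finset.mem_sdiff]
      constructor
      · rintro ⟨z, rfl⟩
        have := heSH z
        tauto
      · intro h
        exact hcov v (by tauto)
    have h3 := Finset.card_add_card_compl ((S \ H) ∪ (H \ S))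
    rw [← h2, h1, Fintype.card_fin, Finset.card_union_of_disjoint ?_] at h3
    · exact h3
    · rw [Finset.disjoint_left]
      intro v
      simp only [Finset.mem_sdiff]
      tauto

/-! ### Programs with bounded loops -/

namespace RAM

/-- The state `s` with `a` written to the register `x`. -/
def State.setVar (s : State) (x a : ℕ) : State := ⟨Function.update s.var x a, s.arr⟩

/-- The state `s` with `b` written to the cell `i` of the array `a`. -/
def State.setArr (s : State) (a i b : ℕ) : State :=
  ⟨s.var, Function.update s.arr a (Function.update (s.arr a) i b)⟩

@[simp] theorem State.setVar_var (s : State) (x a y : ℕ) :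
    (s.setVar x a).var y = if y = x then a else s.var y := Function.update_apply _ _ _ _

@[simp] theorem State.setVar_arr (s : State) (x a : ℕ) : (s.setVar x a).arr = s.arr := rfl

@[simp] theorem State.setArr_var (s : State) (a i b : ℕ) : (s.setArr a i b).var = s.var := rfl

@[simp] theorem State.setArr_arr (s : State) (a i b c : ℕ) :
    (s.setArr a i b).arr c = if c = a then Function.update (s.arr a) i b else s.arr c :=
  Function.update_apply _ _ _ _

/-- Programs in which the number of iterations of a loop is the content of a register. -/
inductive Cmd where
  | skip
  | set (x : ℕ) (e : Expr)
  | put (a : ℕ) (i e : Expr)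
  | seq (p r : Cmd)
  | ite (e : Expr) (p r : Cmd)
  /-- `for x := 0, …, b - 1 do p` -/
  | loop (x b : ℕ) (p : Cmd)

namespace Cmd

/-- Translation into programs of the machine. -/
def toProg : Cmd → Prog
  | skip => .skip
  | set x e => .set x e
  | put a i e => .put a i e
  | seq p r => .seq p.toProg r.toProg
  | ite e p r => .ite e p.toProg r.toProg
  | loop x b p => .seq (.set x (.const 0))
      (.loop (.sub (.var b) (.var x)) (.seq p.toProg (.set x (.add (.var x) (.const 1)))))

/-- The effect of a command on the memory. -/
def den : Cmd → State → State
  | skip, s => s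
  | set x e, s => s.setVar x (e.eval s)
  | put a i e, s => s.setArr a (i.eval s) (e.eval s)
  | seq p r, s => r.den (p.den s)
  | ite e p r, s => if e.eval s ≠ 0 then p.den s else r.den s
  | loop x b p, s =>
      (fun s => (p.den s).setVar x ((p.den s).var x + 1))^[s.var b] (s.setVar x 0)

/-- The registers that a command may change. -/
def vars : Cmd → List ℕ
  | skip => []
  | set x _ => [x]
  | put _ _ _ => []
  | seq p r => p.vars ++ r.vars
  | ite _ p r => p.vars ++ r.vars
  | loop x _ p => x :: p.vars

/-- The arrays that a command may change. -/
def arrs : Cmd → List ℕ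
  | skip => []
  | set _ _ => []
  | put a _ _ => [a]
  | seq p r => p.arrs ++ r.arrs
  | ite _ p r => p.arrs ++ r.arrs
  | loop _ _ p => p.arrs

/-- The loops of the command run over the registers in `bs`, and their bodies change neither
these registers nor the counter. -/
def WF (bs : List ℕ) : Cmd → Prop
  | skip => True
  | set _ _ => True
  | put _ _ _ => True
  | seq p r => p.WF bs ∧ r.WF bs ∧ ∀ b ∈ bs, b ∉ p.vars
  | ite _ p r => p.WF bs ∧ r.WF bs
  | loop x b p => p.WF bs ∧ b ∈ bs ∧ x ∉ bs ∧ (∀ b ∈ bs, b ∉ p.vars) ∧ x ∉ p.vars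

instance decidableWF (bs : List ℕ) : (c : Cmd) → Decidable (c.WF bs)
  | skip => .isTrue trivial
  | set _ _ => .isTrue trivial
  | put _ _ _ => .isTrue trivial
  | seq p r =>
    have := decidableWF bs p
    have := decidableWF bs r
    inferInstanceAs (Decidable (_ ∧ _ ∧ _))
  | ite _ p r =>
    have := decidableWF bs p
    have := decidableWF bs r
    inferInstanceAs (Decidable (_ ∧ _))
  | loop _ _ p =>
    have := decidableWF bs p
    inferInstanceAs (Decidable (_ ∧ _ ∧ _ ∧ _ ∧ _))

/-- A bound on the number of steps, as a polynomial in a bound on the lengths of the loops. -/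
noncomputable def cost : Cmd → Polynomial ℕ
  | skip => .C 1
  | set _ e => .C (e.cost + 1)
  | put _ i e => .C (i.cost + e.cost + 1)
  | seq p r => p.cost + r.cost
  | ite e p r => .C (e.cost + 1) + p.cost + r.cost
  -- `6` pays for the initialization (2) and the final test (4); `8` pays for the test (4) and the
  -- increment (4) of an iteration.
  | loop _ _ p => .C 6 + .X * (.C 8 + p.cost)

theorem den_var (c : Cmd) (s : State) {y : ℕ} (hy : y ∉ c.vars) :
    (c.den s).var y = s.var y := by
  induction c generalizing s with
  | skip => rfl
  | set x e => simp_all [vars, den]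
  | put a i e => rfl
  | seq p r ihp ihr =>
    rw [vars, List.mem_append, not_or] at hy
    rw [den, ihr _ hy.2, ihp _ hy.1]
  | ite e p r ihp ihr =>
    rw [vars, List.mem_append, not_or] at hy
    rw [den]
    split_ifs
    · exact ihp _ hy.1
    · exact ihr _ hy.2
  | loop x b p ih =>
    rw [vars, List.mem_cons, not_or] at hy
    rw [den]
    generalize s.var b = N
    induction N with
    | zero => simp [hy.1]
    | succ N ihN =>
      rw [Function.iterate_succ_apply', State.setVar_var, if_neg hy.1, ih _ hy.2, ihN]

theorem den_arr (c : Cmd) (s : State) {a : ℕ} (ha : a ∉ c.arrs) :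
    (c.den s).arr a = s.arr a := by
  induction c generalizing s with
  | skip => rfl
  | set x e => rfl
  | put a' i e => simp_all [arrs, den]
  | seq p r ihp ihr =>
    rw [arrs, List.mem_append, not_or] at ha
    rw [den, ihr _ ha.2, ihp _ ha.1]
  | ite e p r ihp ihr =>
    rw [arrs, List.mem_append, not_or] at ha
    rw [den]
    split_ifs
    · exact ihp _ ha.1
    · exact ihr _ ha.2
  | loop x b p ih =>
    rw [arrs] at ha
    rw [den]
    generalize s.var b = N
    induction N with
    | zero => simp
    | succ N ihN => rw [Function.iterate_succ_apply', State.setVar_arr, ih _ ha, ihN]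

/-- Induction over the iterations of a loop. The step may use that the iteration starts in a
state that differs from the initial one only in what the body changes. -/
theorem den_loop {x b : ℕ} {p : Cmd} {s : State} (I : ℕ → State → Prop)
    (hx : x ∉ p.vars) (h0 : I 0 (s.setVar x 0))
    (hstep : ∀ i < s.var b, ∀ s' : State, s'.var x = i →
      (∀ y, y ∉ x :: p.vars → s'.var y = s.var y) → (∀ a, a ∉ p.arrs → s'.arr a = s.arr a) →
      I i s' → I (i + 1) ((p.den s').setVar x (i + 1))) :
    I (s.var b) ((loop x b p).den s) := by
  rw [den]
  -- The value of the counter and the unchanged memory are carried along with `I`.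
  suffices h : ∀ N ≤ s.var b, ∀ s' : State,
      s' = (fun s => (p.den s).setVar x ((p.den s).var x + 1))^[N] (s.setVar x 0) →
      I N s' ∧ s'.var x = N ∧ (∀ y, y ∉ x :: p.vars → s'.var y = s.var y) ∧
        ∀ a, a ∉ p.arrs → s'.arr a = s.arr a from (h _ le_rfl _ rfl).1
  intro N
  induction N with
  | zero =>
    rintro - s' rfl
    refine ⟨h0, by simp, fun y hy => ?_, fun a _ => rfl⟩
    rw [List.mem_cons, not_or] at hy
    simp [hy.1]
  | succ N ih =>
    rintro hN s' rfl
    rw [Function.iterate_succ_apply']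
    obtain ⟨h1, h2, h3, h4⟩ := ih (by omega) _ rfl
    set s1 := (fun s => (p.den s).setVar x ((p.den s).var x + 1))^[N] (s.setVar x 0)
    have hx1 : (p.den s1).var x = N := by rw [den_var _ _ hx, h2]
    simp only [hx1]
    refine ⟨hstep N (by omega) s1 h2 h3 h4 h1, by simp, fun y hy => ?_, fun a ha => ?_⟩
    · have hy' := hy
      rw [List.mem_cons, not_or] at hy'
      rw [State.setVar_var, if_neg hy'.1, den_var _ _ hy'.2, h3 y hy]
    · rw [State.setVar_arr, den_arr _ _ ha, h4 a ha]

/-- `den` reads the length of a loop once, whereas the translated loop rereads it before each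
iteration. `WF` makes the two agree, and it keeps the bound `B` valid for all loops to come. -/
theorem run_toProg (bs : List ℕ) (B : ℕ) (c : Cmd) (hc : c.WF bs) (s : State)
    (hs : ∀ b ∈ bs, s.var b ≤ B) : ∃ t ≤ c.cost.eval B, Run c.toProg s t (c.den s) := by
  induction c generalizing s with
  | skip => exact ⟨1, by simp [cost], .skip s⟩
  | set x e => exact ⟨e.cost + 1, by simp [cost], .set s x e⟩
  | put a i e => exact ⟨i.cost + e.cost + 1, by simp [cost], .put s a i e⟩
  | seq p r ihp ihr =>
    obtain ⟨t, ht, h⟩ := ihp hc.1 s hs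
    obtain ⟨t', ht', h'⟩ := ihr hc.2.1 (p.den s) fun b hb => by
      rw [den_var _ _ (hc.2.2 b hb)]
      exact hs b hb
    exact ⟨t + t', by rw [cost, Polynomial.eval_add]; omega, .seq h h'⟩
  | ite e p r ihp ihr =>
    rw [den, cost, Polynomial.eval_add, Polynomial.eval_add, Polynomial.eval_C]
    by_cases he : e.eval s = 0
    · obtain ⟨t, ht, h⟩ := ihr hc.2 s hs
      rw [if_neg (by simpa using he)]
      exact ⟨e.cost + 1 + t, by omega, .iteFalse he h⟩
    · obtain ⟨t, ht, h⟩ := ihp hc.1 s hs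
      rw [if_pos he]
      exact ⟨e.cost + 1 + t, by omega, .iteTrue he h⟩
  | loop x b p ih =>
    obtain ⟨hp, hb, hx, hbs, hxp⟩ := hc
    set F : State → State := fun s => (p.den s).setVar x ((p.den s).var x + 1) with hF
    -- `N` is the number of iterations still to be done.
    have key : ∀ N ≤ B, ∀ s' : State, (∀ b ∈ bs, s'.var b ≤ B) → s'.var x + N = s'.var b →
        ∃ t ≤ 4 + N * (8 + p.cost.eval B),
          Run (.loop (.sub (.var b) (.var x))
            (.seq p.toProg (.set x (.add (.var x) (.const 1))))) s' t (F^[N] s') := by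
      intro N
      induction N with
      | zero =>
        intro _ s' _ h
        exact ⟨_, by simp [Expr.cost], .loopDone (by simp [Expr.eval]; omega)⟩
      | succ N ihN =>
        intro hN s' hs' h
        obtain ⟨t, ht, hrun⟩ := ih hp s' hs'
        have hFb : ∀ b ∈ bs, (F s').var b = s'.var b := fun b hb => by
          have : b ≠ x := fun h => hx (h ▸ hb)
          rw [hF, State.setVar_var, if_neg this, den_var _ _ (hbs b hb)]
        have hFx : (F s').var x = s'.var x + 1 := by
          rw [hF, State.setVar_var, if_pos rfl, den_var _ _ hxp]
        obtain ⟨t', ht', hrun'⟩ := ihN (by omega) (F s')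
          (fun b hb => by rw [hFb b hb]; exact hs' b hb) (by rw [hFb b hb, hFx]; omega)
        rw [Function.iterate_succ_apply]
        refine ⟨_, ?_, .loopStep (by simp [Expr.eval]; omega) (.seq hrun (.set _ _ _)) hrun'⟩
        simp only [Expr.cost]
        rw [Nat.add_mul]
        omega
    obtain ⟨t, ht, hrun⟩ := key (s.var b) (hs b hb) (s.setVar x 0)
      (fun b' hb' => by
        have : b' ≠ x := fun h => hx (h ▸ hb')
        rw [State.setVar_var, if_neg this]
        exact hs b' hb')
      (by
        have : b ≠ x := fun h => hx (h ▸ hb)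
        simp [this])
    refine ⟨2 + t, ?_, .seq (.set _ _ _) hrun⟩
    have := Nat.mul_le_mul_right (8 + p.cost.eval B) (hs b hb)
    simp only [cost, Polynomial.eval_add, Polynomial.eval_mul, Polynomial.eval_C,
      Polynomial.eval_X]
    omega

end Cmd

end RAM

/-! ### Maximum matchings of the bipartite double cover by auction -/

/-- The left copy of `u` is matched to the right copy of `L u - 1` unless `L u = 0`, the right copy
of `v` is matched to the left copy of `R v - 1` unless `R v = 0`, and `p` are the prices of the
right copies. -/
structure AuctionInv (n : ℕ) (A : ℕ → ℕ → Prop) (p L R : ℕ → ℕ) : Prop where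
  left : ∀ u < n, L u ≠ 0 → L u - 1 < n ∧ A u (L u - 1) ∧ R (L u - 1) = u + 1
  right : ∀ v < n, R v ≠ 0 → R v - 1 < n ∧ L (R v - 1) = v + 1
  matched : ∀ v < n, p v ≠ 0 → R v ≠ 0
  happy : ∀ u < n, L u ≠ 0 → ∀ w < n, A u w → p (L u - 1) ≤ p w + 1
  bound : ∀ v < n, p v ≤ n + 1

/-- The left copy of `u` does not want to bid any more. -/
def AuctionDone (n : ℕ) (A : ℕ → ℕ → Prop) (p L : ℕ → ℕ) (u : ℕ) : Prop :=
  L u ≠ 0 ∨ ∀ v < n, A u v → n + 1 ≤ p v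

/-- The slack of one in `happy` absorbs the raise of a cheapest neighbor's price. Prices never fall,
so the other matched vertices stay happy; the only one whose own price rises is the previous owner
of `v`, who loses it. -/
theorem AuctionInv.bid {n : ℕ} {A : ℕ → ℕ → Prop} {p L R : ℕ → ℕ} (h : AuctionInv n A p L R)
    {u v : ℕ} (hu : u < n) (hLu : L u = 0) (hv : v < n) (huv : A u v) (hp : p v < n + 1)
    (hmin : ∀ w < n, A u w → p v ≤ p w) :
    AuctionInv n A (Function.update p v (p v + 1))
      (Function.update (if R v = 0 then L else Function.update L (R v - 1) 0) u (v + 1))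
      (Function.update R v (u + 1)) := by
  obtain ⟨h1, h2, h3, h4, h5⟩ := h
  -- The three cases are the bidder, the displaced owner, and everybody else.
  have hL (a : ℕ) : Function.update (if R v = 0 then L else Function.update L (R v - 1) 0) u (v + 1)
      a = if a = u then v + 1 else if R v = a + 1 then 0 else L a := by
    rw [Function.update_apply]
    split_ifs with h h' h'' h'' <;> try first | rfl | omega
    · rw [Function.update_apply, if_pos (by omega)]
    · rw [Function.update_apply, if_neg (by omega)]
  generalize Function.update (if R v = 0 then L else Function.update L (R v - 1) 0) u (v + 1) = L'
    at hL ⊢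
  constructor
  · intro a ha
    rw [hL]
    split_ifs with h h'
    · simp [h, huv, hv]
    · simp
    · intro h0
      obtain ⟨h6, h7, h8⟩ := h1 a ha h0
      refine ⟨h6, h7, ?_⟩
      rw [Function.update_of_ne ?_, h8]
      intro h9
      rw [h9] at h8
      exact h' h8
  · intro w hw
    rw [Function.update_apply]
    split_ifs with h
    · simp [h, hu, hL]
    · intro h0
      obtain ⟨h6, h7⟩ := h2 w hw h0
      refine ⟨h6, ?_⟩
      have h8 : R w - 1 ≠ u := by
        intro h8
        rw [h8, hLu] at h7
        omega
      have h9 : R v ≠ R w - 1 + 1 := by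
        intro h9
        have := (h2 v hv (by omega)).2
        rw [h9, Nat.add_sub_cancel, h7] at this
        omega
      rw [hL, if_neg h8, if_neg h9, h7]
  · intro w hw
    rw [Function.update_apply, Function.update_apply]
    split_ifs with h
    · simp
    · exact h3 w hw
  · intro a ha
    rw [hL]
    intro h0 w hw haw
    have hle (w : ℕ) : p w ≤ Function.update p v (p v + 1) w := by
      rw [Function.update_apply]
      split_ifs with h
      · rw [h]
        omega
      · exact le_rfl
    split_ifs at h0 ⊢ with h h'
    · rw [Nat.add_sub_cancel, Function.update_self]
      have := hmin w hw (h ▸ haw)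
      have := hle w
      omega
    · exact absurd rfl h0
    · rw [Function.update_of_ne ?_]
      · have := h4 a ha h0 w hw haw
        have := hle w
        omega
      · intro h9
        obtain ⟨-, -, h8⟩ := h1 a ha h0
        rw [h9] at h8
        exact h' h8
  · intro w hw
    rw [Function.update_apply]
    split_ifs with h
    · omega
    · exact h5 w hw

/-- A set of left copies and the set of their neighbors, cut out by a gap `j` between the prices. -/
theorem AuctionInv.crown {n : ℕ} {A : ℕ → ℕ → Prop} {p L R : ℕ → ℕ} (h : AuctionInv n A p L R)
    (hdone : ∀ u < n, AuctionDone n A p L u) {j : ℕ} (hj : j ≤ n + 1) (hgap : ∀ v < n, p v ≠ j) :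
    (∀ u < n, (L u = 0 ∨ j < p (L u - 1)) → ∀ v < n, A u v → j < p v) ∧
    (∀ v < n, j < p v → R v - 1 < n ∧ j < p (L (R v - 1) - 1) ∧ A (R v - 1) v ∧
      L (R v - 1) = v + 1) ∧
    (∀ u < n, L u ≠ 0 → L u - 1 < n ∧ A u (L u - 1) ∧ R (L u - 1) = u + 1) := by
  refine ⟨fun u hu hS v hv huv => ?_, fun v hv hp => ?_, h.left⟩
  · have h1 := hgap v hv
    by_cases hL : L u = 0
    · have := (hdone u hu).resolve_left (by simpa using hL) v hv huv
      omega
    · have := h.happy u hu hL v hv huv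
      omega
  · obtain ⟨h1, h2⟩ := h.right v hv (h.matched v hv (by omega))
    have h3 := h.left _ h1 (by omega)
    rw [h2, Nat.add_sub_cancel] at *
    exact ⟨h1, hp, h3.2.1, rfl⟩

/-! ### The auction and the search for a gap as programs, and their correctness -/

namespace RAM

/-- The part of the memory that describes the input. -/
structure Static (n : ℕ) (A : ℕ → ℕ → Prop) (s : State) : Prop where
  -- Arrays `0` and `1` hold the matrix and its row offsets, `2`, `3`, `4` hold `p`, `L`, `R`, array
  -- `6` lists the kept vertices, and `7` and `8` hold the new matrix and its row offsets.
  var_zero : s.var 0 = n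
  var_two : s.var 2 = n + 1
  adj : ∀ u < n, ∀ v < n, (A u v → s.arr 0 (s.arr 1 u + v) = 1) ∧
    (¬ A u v → s.arr 0 (s.arr 1 u + v) = 0)

theorem Static.congr {n : ℕ} {A : ℕ → ℕ → Prop} {s s' : State} (h : Static n A s)
    (h0 : s'.var 0 = s.var 0) (h2 : s'.var 2 = s.var 2) (ha0 : s'.arr 0 = s.arr 0)
    (ha1 : s'.arr 1 = s.arr 1) : Static n A s' :=
  ⟨h0.trans h.1, h2.trans h.2, by rw [ha0, ha1]; exact h.3⟩

theorem Static.den {n : ℕ} {A : ℕ → ℕ → Prop} {s : State} (h : Static n A s) (c : Cmd)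
    (hv : 0 ∉ c.vars ∧ 2 ∉ c.vars) (ha : 0 ∉ c.arrs ∧ 1 ∉ c.arrs) : Static n A (c.den s) :=
  h.congr (c.den_var s hv.1) (c.den_var s hv.2) (c.den_arr s ha.1) (c.den_arr s ha.2)

open Cmd in
/-- `a[u] := u * b` for all vertices `u` -/
def mulTable (a b : ℕ) : Cmd :=
  .seq (.set 14 (.const 0)) <|
  .loop 5 0 <|
    .seq (.put a (.var 5) (.var 14)) (.set 14 (.add (.var 14) (.var b)))

/-- The register `7` receives `v + 1` for a cheapest neighbor `v` of the vertex in register `5`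
that has price at most `n`, or `0` if there is none. -/
def scan : Cmd :=
  -- The best price starts at the cap `n + 1`, so neighbors that have reached it are never chosen.
  .seq (.set 7 (.const 0)) <| .seq (.set 8 (.var 2)) <|
  .loop 6 0 <|
    .ite (.get 0 (.add (.get 1 (.var 5)) (.var 6)))
      (.ite (.sub (.var 8) (.get 2 (.var 6)))
        (.seq (.set 7 (.add (.var 6) (.const 1))) (.set 8 (.get 2 (.var 6))))
        .skip)
      .skip

/-- The vertex `u` in register `5` is matched to `v`, where `v + 1` is in register `7`. -/
def take : Cmd :=
  .seq (.ite (.get 4 (.sub (.var 7) (.const 1)))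
    (.put 3 (.sub (.get 4 (.sub (.var 7) (.const 1))) (.const 1)) (.const 0)) .skip) <|
  .seq (.put 4 (.sub (.var 7) (.const 1)) (.add (.var 5) (.const 1))) <|
  .seq (.put 3 (.var 5) (.var 7)) <|
  .put 2 (.sub (.var 7) (.const 1)) (.add (.get 2 (.sub (.var 7) (.const 1))) (.const 1))

/-- One bid of the vertex in register `5`. -/
def bid : Cmd :=
  .ite (.get 3 (.var 5)) .skip (.seq scan (.ite (.var 7) take .skip))

/-- Bids until nobody wants to bid any more. -/
def auction : Cmd :=
  -- There are `(n + 1) * n` sweeps, as many as the largest possible sum of prices.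
  .loop 3 2 (.loop 4 0 (.loop 5 0 bid))

/-- The register `10` tells whether some vertex has the price that is one more than the content of
register `9`. -/
def findLevel : Cmd :=
  .seq (.set 10 (.const 0)) <|
  .loop 6 0 <|
    -- The sum of the two truncated differences vanishes only for equal numbers.
    .ite (.add (.sub (.get 2 (.var 6)) (.add (.var 9) (.const 1)))
      (.sub (.add (.var 9) (.const 1)) (.get 2 (.var 6)))) .skip (.set 10 (.const 1))

/-- A number that is at most `n + 1` and not the price of a vertex is written to register `11`. -/
def findGap : Cmd :=
  .seq (.set 11 (.const 0)) <|
  .loop 9 2 <|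
    .seq findLevel <| .ite (.var 10) .skip (.set 11 (.add (.var 9) (.const 1)))

/-- The vertex in register `5` is added to the list in the array `6`. -/
def keep : Cmd :=
  .seq (.put 6 (.var 12) (.var 5)) (.set 12 (.add (.var 12) (.const 1)))

/-- The vertices outside of the crown are listed in the array `6`. Their number is written to
register `12`, and the number of vertices in the head of the crown to register `13`. -/
def classify : Cmd :=
  .seq (.set 12 (.const 0)) <| .seq (.set 13 (.const 0)) <|
  .loop 5 0 <|
    .seq (.ite (.get 3 (.var 5))
      (.set 10 (.sub (.get 2 (.sub (.get 3 (.var 5)) (.const 1))) (.var 11)))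
      (.set 10 (.const 1))) <|
    .ite (.var 10)
      -- Register `10` decides membership in `S`, the inner tests membership in `H`. Vertices of `S
      -- \ H` are dropped uncounted, as only the head changes the parameter.
      (.ite (.sub (.get 2 (.var 5)) (.var 11)) keep .skip)
      (.ite (.sub (.get 2 (.var 5)) (.var 11)) (.set 13 (.add (.var 13) (.const 1))) keep)

/-- The adjacency matrix of the graph on the vertices listed in the array `6` is written to the
array `7`. -/
def gather : Cmd :=
  .loop 5 0 <| .loop 6 0 <|
    .ite (.sub (.var 12) (.var 5))
      (.ite (.sub (.var 12) (.var 6))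
        (.put 7 (.add (.get 8 (.var 5)) (.var 6))
          (.get 0 (.add (.get 1 (.get 6 (.var 5))) (.get 6 (.var 6)))))
        .skip)
      .skip

/-- The array `7` is copied to the array `0`, as far as it is filled. -/
def copyBack : Cmd :=
  .loop 5 0 <| .loop 6 0 <|
    .put 0 (.add (.get 8 (.var 5)) (.var 6)) (.get 7 (.add (.get 8 (.var 5)) (.var 6)))

/-- Multiplication is not an instruction of the machine, so the row offsets of both matrices are
tabulated by repeated addition. -/
theorem mulTable_spec (a b : ℕ) (hb : b ≠ 14 ∧ b ≠ 5) (s : State) :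
    ∀ u < s.var 0, ((mulTable a b).den s).arr a u = u * s.var b := by
  have h := Cmd.den_loop (x := 5) (b := 0) (s := s.setVar 14 0)
    (p := .seq (.put a (.var 5) (.var 14)) (.set 14 (.add (.var 14) (.var b))))
    (fun i s' => s'.var 14 = i * s.var b ∧ ∀ u < i, s'.arr a u = u * s.var b)
    (by simp [Cmd.vars]) (by simp) ?_
  · exact h.2
  · rintro i - s' hi hv - ⟨h1, h2⟩
    have hvb := hv b (by simp [Cmd.vars, hb])
    simp only [State.setVar_var, if_neg hb.1] at hvb
    simp only [Cmd.den, Expr.eval, State.setVar_var, State.setVar_arr, State.setArr_var,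
      State.setArr_arr, hvb, h1, hi, if_true, Function.update_apply]
    refine ⟨by simp; ring, fun u hu => ?_⟩
    grind

theorem scan_spec {n : ℕ} {A : ℕ → ℕ → Prop} {s : State} (hs : Static n A s)
    (hu : s.var 5 < n) :
    ((scan.den s).var 7 = 0 ∧ ∀ v < n, A (s.var 5) v → n + 1 ≤ s.arr 2 v) ∨
    ((scan.den s).var 7 ≠ 0 ∧ (scan.den s).var 7 - 1 < n ∧ A (s.var 5) ((scan.den s).var 7 - 1) ∧
      s.arr 2 ((scan.den s).var 7 - 1) < n + 1 ∧
      ∀ v < n, A (s.var 5) v → s.arr 2 ((scan.den s).var 7 - 1) ≤ s.arr 2 v) := by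
  have h := Cmd.den_loop (x := 6) (b := 0) (s := (s.setVar 7 0).setVar 8 (s.var 2))
    (p := .ite (.get 0 (.add (.get 1 (.var 5)) (.var 6)))
      (.ite (.sub (.var 8) (.get 2 (.var 6)))
        (.seq (.set 7 (.add (.var 6) (.const 1))) (.set 8 (.get 2 (.var 6))))
        .skip)
      .skip)
    (fun i s' => (∀ v < i, A (s.var 5) v → s'.var 8 ≤ s.arr 2 v) ∧
      ((s'.var 7 = 0 ∧ s'.var 8 = n + 1) ∨ (s'.var 7 ≠ 0 ∧ s'.var 7 - 1 < n ∧
        A (s.var 5) (s'.var 7 - 1) ∧ s.arr 2 (s'.var 7 - 1) < n + 1 ∧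
        s'.var 8 = s.arr 2 (s'.var 7 - 1))))
    (by decide) ⟨by simp, by simp [hs.var_two]⟩ ?_
  · have h0 : ((s.setVar 7 0).setVar 8 (s.var 2)).var 0 = n := by simp [hs.var_zero]
    rw [h0] at h
    have hden : scan.den s = (Cmd.loop 6 0 (.ite (.get 0 (.add (.get 1 (.var 5)) (.var 6)))
      (.ite (.sub (.var 8) (.get 2 (.var 6)))
        (.seq (.set 7 (.add (.var 6) (.const 1))) (.set 8 (.get 2 (.var 6))))
        .skip)
      .skip)).den ((s.setVar 7 0).setVar 8 (s.var 2)) := rfl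
    rw [hden]
    grind
  · intro i hi s' hi6 hv ha ⟨h1, h2⟩
    replace hi : i < n := by simpa [hs.var_zero] using hi
    have hv5 : s'.var 5 = s.var 5 := by simpa using hv 5 (by decide)
    have ha0 : s'.arr 0 = s.arr 0 := ha 0 (by decide)
    have ha1 : s'.arr 1 = s.arr 1 := ha 1 (by decide)
    have ha2 : s'.arr 2 = s.arr 2 := ha 2 (by decide)
    have hadj := hs.adj _ hu i hi
    simp only [Cmd.den, Expr.eval, hv5, ha0, ha1, ha2, hi6]
    by_cases hA : A (s.var 5) i
    · rw [if_pos (by simp [hadj.1 hA])]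
      by_cases hp : s.arr 2 i < s'.var 8
      · rw [if_pos (by omega)]
        simp only [State.setVar_var, State.setVar_arr, ha2, hi6]
        grind
      · rw [if_neg (by omega)]
        simp only [State.setVar_var]
        grind
    · rw [if_neg (by simp [hadj.2 hA])]
      simp only [State.setVar_var]
      grind

/-- The matching and the prices in the memory satisfy the invariants of the auction. -/
def Auction (n : ℕ) (A : ℕ → ℕ → Prop) (s : State) : Prop :=
  AuctionInv n A (s.arr 2) (s.arr 3) (s.arr 4)

/-- Nobody wants to bid any more. -/
def Finished (n : ℕ) (A : ℕ → ℕ → Prop) (s : State) : Prop :=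
  ∀ u < n, AuctionDone n A (s.arr 2) (s.arr 3) u

/-- The sum of all prices. -/
def total (n : ℕ) (s : State) : ℕ := ∑ v ∈ Finset.range n, s.arr 2 v

/-- The sum of the prices measures progress: a visit either leaves all arrays alone or increases it.
-/
theorem bid_spec {n : ℕ} {A : ℕ → ℕ → Prop} {s : State} (hs : Static n A s)
    (hu : s.var 5 < n) (hI : Auction n A s) :
    (AuctionDone n A (s.arr 2) (s.arr 3) (s.var 5) ∧ ∀ a, (bid.den s).arr a = s.arr a) ∨
    (¬ AuctionDone n A (s.arr 2) (s.arr 3) (s.var 5) ∧ Auction n A (bid.den s) ∧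
      total n s < total n (bid.den s)) := by
  by_cases hL : s.arr 3 (s.var 5) = 0
  · have hden : bid.den s =
        if (scan.den s).var 7 ≠ 0 then take.den (scan.den s) else scan.den s := by
      rw [bid, Cmd.den, if_neg (by simpa [Expr.eval] using hL)]
      rfl
    have harr : ∀ a, (scan.den s).arr a = s.arr a := fun a =>
      Cmd.den_arr _ _ (by simp [scan, Cmd.arrs])
    have hv5 : (scan.den s).var 5 = s.var 5 := Cmd.den_var _ _ (by decide)
    rw [hden]
    rcases scan_spec hs hu with ⟨h7, hdone⟩ | ⟨h7, hlt, hA, hp, hmin⟩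
    · rw [if_neg (by simpa using h7)]
      exact .inl ⟨.inr hdone, harr⟩
    · rw [if_pos h7]
      refine .inr ⟨?_, ?_⟩
      · rintro (h | h)
        · exact h hL
        · have := h _ hlt hA
          omega
      generalize hb : (scan.den s).var 7 = b at *
      have key := AuctionInv.bid hI hu hL hlt hA hp hmin
      rw [Nat.sub_add_cancel (by omega)] at key
      have h2 : (take.den (scan.den s)).arr 2 =
          Function.update (s.arr 2) (b - 1) (s.arr 2 (b - 1) + 1) := by
        by_cases hR : s.arr 4 (b - 1) = 0 <;>
          simp [take, Cmd.den, Expr.eval, hb, harr, hR]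
      refine ⟨?_, ?_⟩
      · rw [Auction, h2]
        by_cases hR : s.arr 4 (b - 1) = 0 <;> simp only [hR, if_true, if_false] at key <;>
          simpa [take, Cmd.den, Expr.eval, hb, harr, hR, hv5] using key
      · rw [total, total, h2]
        refine Finset.sum_lt_sum (fun v _ => ?_) ⟨b - 1, Finset.mem_range.2 hlt, by simp⟩
        rw [Function.update_apply]
        split_ifs with h
        · rw [h]
          omega
        · exact le_rfl
  · have hden : bid.den s = s := by simp [bid, Cmd.den, Expr.eval, hL]
    rw [hden]
    exact .inl ⟨.inl hL, fun _ => rfl⟩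

/-- A sweep without any bid certifies that every vertex is done; any bid increases the sum of the
prices. -/
theorem sweep_spec {n : ℕ} {A : ℕ → ℕ → Prop} {s : State} (hs : Static n A s)
    (hI : Auction n A s) :
    Auction n A ((Cmd.loop 5 0 bid).den s) ∧
      (Finished n A ((Cmd.loop 5 0 bid).den s) ∨
        (¬ Finished n A s ∧ total n s < total n ((Cmd.loop 5 0 bid).den s))) := by
  have h := Cmd.den_loop (x := 5) (b := 0) (s := s) (p := bid)
    (fun i s' => Auction n A s' ∧
      ((s'.arr 2 = s.arr 2 ∧ s'.arr 3 = s.arr 3 ∧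
          ∀ u < i, AuctionDone n A (s.arr 2) (s.arr 3) u) ∨
        (¬ Finished n A s ∧ total n s < total n s')))
    (by decide) ⟨hI, .inl ⟨rfl, rfl, by simp⟩⟩ ?_
  · rw [hs.var_zero] at h
    refine ⟨h.1, h.2.imp_left fun h => ?_⟩
    rw [Finished, h.1, h.2.1]
    exact h.2.2
  · intro i hi s' hi5 hv ha ⟨h1, h2⟩
    rw [hs.var_zero] at hi
    have hs' : Static n A s' :=
      hs.congr (hv 0 (by decide)) (hv 2 (by decide)) (ha 0 (by decide)) (ha 1 (by decide))
    have hb := bid_spec hs' (hi5 ▸ hi) h1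
    rw [hi5] at hb
    simp only [Auction, total, State.setVar_arr] at *
    rcases hb with ⟨hd, heq⟩ | ⟨hd, hI', hlt⟩
    · simp only [heq]
      refine ⟨h1, h2.imp_left fun h => ⟨h.1, h.2.1, fun u hu => ?_⟩⟩
      rcases Nat.lt_succ_iff_lt_or_eq.1 hu with hu | rfl
      · exact h.2.2 u hu
      · rwa [h.1, h.2.1] at hd
    · refine ⟨hI', .inr ?_⟩
      rcases h2 with ⟨h2, h3, -⟩ | ⟨h2, h3⟩
      · rw [h2, h3] at hd
        rw [h2] at hlt
        exact ⟨fun h => hd (h i hi), hlt⟩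
      · exact ⟨h2, h3.trans hlt⟩

theorem auction_spec {n : ℕ} {A : ℕ → ℕ → Prop} {s : State} (hs : Static n A s)
    (hI : Auction n A s) : Auction n A (auction.den s) ∧ Finished n A (auction.den s) := by
  have h := Cmd.den_loop (x := 3) (b := 2) (s := s) (p := .loop 4 0 (.loop 5 0 bid))
    (fun i s' => Auction n A s' ∧ (Finished n A s' ∨ i * n ≤ total n s'))
    (by decide) ⟨hI, .inr (by simp)⟩ ?_
  · refine ⟨h.1, h.2.elim id fun h' => ?_⟩
    change s.var 2 * n ≤ total n (auction.den s) at h'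
    rw [hs.var_two] at h'
    have hp : ∀ v < n, (auction.den s).arr 2 v ≤ n + 1 := h.1.bound
    have heq : ∀ v ∈ Finset.range n, (auction.den s).arr 2 v = n + 1 := by
      refine (Finset.sum_eq_sum_iff_of_le fun v hv => hp v (Finset.mem_range.1 hv)).1 ?_
      -- If the auction has not stopped earlier, the total has reached `(n + 1) * n`; so every price
      -- is at the cap, and no neighbor is left to bid on.
      refine le_antisymm (Finset.sum_le_sum fun v hv => hp v (Finset.mem_range.1 hv)) ?_
      rw [Finset.sum_const, Finset.card_range, smul_eq_mul, Nat.mul_comm]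
      exact h'
    exact fun u _ => .inr fun v hv _ => (heq v (Finset.mem_range.2 hv)).ge
  · intro i _ s' _ hv ha ⟨h1, h2⟩
    have hs' : Static n A s' :=
      hs.congr (hv 0 (by decide)) (hv 2 (by decide)) (ha 0 (by decide)) (ha 1 (by decide))
    have h := Cmd.den_loop (x := 4) (b := 0) (s := s') (p := .loop 5 0 bid)
      (fun j s'' => Auction n A s'' ∧ (Finished n A s'' ∨ i * n + j ≤ total n s''))
      (by decide) ⟨h1, h2⟩ ?_
    · rw [hs'.var_zero, ← Nat.succ_mul] at h
      exact h
    · intro j _ s'' _ hv ha ⟨h1, h2⟩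
      have hs'' : Static n A s'' :=
        hs'.congr (hv 0 (by decide)) (hv 2 (by decide)) (ha 0 (by decide)) (ha 1 (by decide))
      obtain ⟨h3, h4⟩ := sweep_spec hs'' h1
      refine ⟨h3, ?_⟩
      rcases h4 with h4 | ⟨h4, h5⟩
      · exact .inl h4
      · refine .inr ?_
        have := h2.resolve_left h4
        change i * n + (j + 1) ≤ total n ((Cmd.loop 5 0 bid).den s'')
        omega

theorem findLevel_spec (s : State) :
    (findLevel.den s).var 10 ≠ 0 ↔ ∃ v < s.var 0, s.arr 2 v = s.var 9 + 1 := by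
  refine Cmd.den_loop (x := 6) (b := 0) (s := s.setVar 10 0)
    (p := .ite (.add (.sub (.get 2 (.var 6)) (.add (.var 9) (.const 1)))
      (.sub (.add (.var 9) (.const 1)) (.get 2 (.var 6)))) .skip (.set 10 (.const 1)))
    (fun j s' => s'.var 10 ≠ 0 ↔ ∃ v < j, s.arr 2 v = s.var 9 + 1) (by decide) (by simp) ?_
  intro j _ s' hj hv ha hI
  have h9 : s'.var 9 = s.var 9 := by simpa using hv 9 (by decide)
  have ha2 : s'.arr 2 = s.arr 2 := ha 2 (by decide)
  simp only [Cmd.den, Expr.eval, h9, ha2, hj]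
  by_cases hj : s.arr 2 j = s.var 9 + 1
  · rw [if_neg (by omega)]
    simp only [State.setVar_var]
    exact ⟨fun _ => ⟨j, by omega, hj⟩, by simp⟩
  · rw [if_pos (by omega)]
    simp only [State.setVar_var]
    refine Iff.trans hI ⟨fun ⟨v, hv, h⟩ => ⟨v, by omega, h⟩, fun ⟨v, hv, h⟩ => ⟨v, ?_, h⟩⟩
    rcases Nat.lt_succ_iff_lt_or_eq.1 hv with hv | rfl
    · exact hv
    · exact absurd h hj

theorem findGap_spec {n : ℕ} {s : State} (h0 : s.var 0 = n) (h2 : s.var 2 = n + 1) :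
    (findGap.den s).var 11 ≤ n + 1 ∧ ∀ v < n, s.arr 2 v ≠ (findGap.den s).var 11 := by
  have h := Cmd.den_loop (x := 9) (b := 2) (s := s.setVar 11 0)
    (p := .seq findLevel <| .ite (.var 10) .skip (.set 11 (.add (.var 9) (.const 1))))
    (fun i s' => (s'.var 11 = 0 ∧ ∀ c < i, ∃ v < n, s.arr 2 v = c + 1) ∨
      (s'.var 11 ≤ n + 1 ∧ ∀ v < n, s.arr 2 v ≠ s'.var 11))
    (by decide) (.inl (by simp)) ?_
  · refine h.resolve_left fun ⟨_, h⟩ => ?_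
    rw [State.setVar_var, if_neg (by decide), h2] at h
    -- The default `0` is never the final answer for want of a gap: the `n + 1` values `1, …, n + 1`
    -- cannot all be prices of `n` vertices.
    choose f hf hf' using fun c : Fin (n + 1) => h c c.2
    have hinj : Function.Injective fun c => (⟨f c, hf c⟩ : Fin n) := by
      intro c d hcd
      have h1 : f c = f d := by simpa using hcd
      have h3 := hf' c
      rw [h1, hf' d] at h3
      exact Fin.ext (by omega)
    have := Fintype.card_le_of_injective _ hinj
    simp at this
  · intro i hi s' hi9 hv ha hI
    rw [State.setVar_var, if_neg (by decide), h2] at hi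
    have ha2 : s'.arr 2 = s.arr 2 := ha 2 (by decide)
    have hv0 : s'.var 0 = n := by rw [hv 0 (by decide)]; simpa using h0
    have h := findLevel_spec s'
    have h9 : (findLevel.den s').var 9 = s'.var 9 := Cmd.den_var _ _ (by decide)
    have h11 : (findLevel.den s').var 11 = s'.var 11 := Cmd.den_var _ _ (by decide)
    rw [ha2, hi9, hv0] at h
    rw [Cmd.den, Cmd.den, Expr.eval]
    by_cases h10 : (findLevel.den s').var 10 = 0
    · rw [if_neg (by simpa using h10)]
      refine .inr ?_
      simp only [Cmd.den, Expr.eval, State.setVar_var, h9, hi9]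
      exact ⟨by simpa using hi, fun v hv hv' => h.2 ⟨v, hv, by simpa using hv'⟩ h10⟩
    · rw [if_pos h10, Cmd.den, State.setVar_var, if_neg (by decide), h11]
      refine hI.imp_left fun hI => ⟨hI.1, fun c hc => ?_⟩
      rcases Nat.lt_succ_iff_lt_or_eq.1 hc with hc | rfl
      · exact hI.2 c hc
      · exact h.1 h10

end RAM

/-! ### Removing the crown and writing the reduced instance -/

namespace RAM

theorem Cmd.den_ite_of_ne {e : Expr} {p r : Cmd} {s : State} (h : e.eval s ≠ 0) :
    (ite e p r).den s = p.den s := if_pos h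

theorem Cmd.den_ite_of_eq {e : Expr} {p r : Cmd} {s : State} (h : e.eval s = 0) :
    (ite e p r).den s = r.den s := if_neg (not_not.2 h)

/-- The array `6` lists the first `i` vertices that are either in both of `S` and `H` or in none of
them. -/
structure Classified (S H : ℕ → Prop) [DecidablePred S] [DecidablePred H] (i : ℕ) (s : State) :
    Prop where
  head : s.var 13 = {u ∈ Finset.range i | H u ∧ ¬ S u}.card
  mem : ∀ t < s.var 12, s.arr 6 t < i ∧ (S (s.arr 6 t) ↔ H (s.arr 6 t))
  surj : ∀ u < i, (S u ↔ H u) → ∃ t < s.var 12, s.arr 6 t = u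
  lt : ∀ t < s.var 12, ∀ t' < t, s.arr 6 t' < s.arr 6 t

section

variable {S H : ℕ → Prop} [DecidablePred S] [DecidablePred H] {i : ℕ} {s s' : State}

theorem card_head_succ : {u ∈ Finset.range (i + 1) | H u ∧ ¬ S u}.card =
    {u ∈ Finset.range i | H u ∧ ¬ S u}.card + if H i ∧ ¬ S i then 1 else 0 := by
  rw [Finset.range_add_one, Finset.filter_insert]
  split_ifs
  · rw [Finset.card_insert_of_notMem (by simp)]
  · rfl

theorem Classified.keep (h : Classified S H i s) (hSH : S i ↔ H i)
    (h13 : s'.var 13 = s.var 13) (h12 : s'.var 12 = s.var 12 + 1)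
    (h6 : s'.arr 6 = Function.update (s.arr 6) (s.var 12) i) : Classified S H (i + 1) s' := by
  have hlt (t : ℕ) (ht : t < s.var 12) :
      Function.update (s.arr 6) (s.var 12) i t = s.arr 6 t :=
    Function.update_of_ne ht.ne _ _
  constructor
  · rw [h13, h.head, card_head_succ, if_neg (by tauto), add_zero]
  · rw [h12, h6]
    intro t ht
    rcases Nat.lt_succ_iff_lt_or_eq.1 ht with ht | rfl
    · rw [hlt t ht]
      exact ⟨(h.mem t ht).1.trans (Nat.lt_succ_self i), (h.mem t ht).2⟩
    · simp [hSH]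
  · rw [h12, h6]
    intro u hu hSHu
    rcases Nat.lt_succ_iff_lt_or_eq.1 hu with hu | rfl
    · obtain ⟨t, ht, rfl⟩ := h.surj u hu hSHu
      exact ⟨t, by omega, hlt t ht⟩
    · exact ⟨s.var 12, by omega, by simp⟩
  · rw [h12, h6]
    intro t ht t' ht'
    rw [hlt t' (by omega)]
    rcases Nat.lt_succ_iff_lt_or_eq.1 ht with ht | rfl
    · rw [hlt t ht]
      exact h.lt t ht t' ht'
    · rw [Function.update_self]
      exact (h.mem t' ht').1

theorem Classified.skip (h : Classified S H i s) (hSH : ¬ (S i ↔ H i))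
    (h13 : s'.var 13 = s.var 13 + if H i ∧ ¬ S i then 1 else 0) (h12 : s'.var 12 = s.var 12)
    (h6 : s'.arr 6 = s.arr 6) : Classified S H (i + 1) s' := by
  constructor
  · rw [h13, h.head, card_head_succ]
  · rw [h12, h6]
    exact fun t ht => ⟨(h.mem t ht).1.trans (Nat.lt_succ_self i), (h.mem t ht).2⟩
  · rw [h12, h6]
    intro u hu hSHu
    rcases Nat.lt_succ_iff_lt_or_eq.1 hu with hu | rfl
    · exact h.surj u hu hSHu
    · exact absurd hSHu hSH
  · rw [h12, h6]
    exact h.lt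

theorem classify_spec (hS : ∀ u, S u ↔ s.arr 3 u = 0 ∨ s.var 11 < s.arr 2 (s.arr 3 u - 1))
    (hH : ∀ v, H v ↔ s.var 11 < s.arr 2 v) :
    Classified S H (s.var 0) (classify.den s) := by
  refine Cmd.den_loop (x := 5) (b := 0) (s := (s.setVar 12 0).setVar 13 0)
    (p := .seq (.ite (.get 3 (.var 5))
      (.set 10 (.sub (.get 2 (.sub (.get 3 (.var 5)) (.const 1))) (.var 11)))
      (.set 10 (.const 1))) <|
    .ite (.var 10)
      (.ite (.sub (.get 2 (.var 5)) (.var 11)) keep .skip)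
      (.ite (.sub (.get 2 (.var 5)) (.var 11)) (.set 13 (.add (.var 13) (.const 1))) keep))
    (Classified S H) (by decide) (by constructor <;> simp) ?_
  intro i _ s' hi hv ha hI
  have hv11 : s'.var 11 = s.var 11 := by simpa using hv 11 (by decide)
  have ha2 : s'.arr 2 = s.arr 2 := ha 2 (by decide)
  have ha3 : s'.arr 3 = s.arr 3 := ha 3 (by decide)
  rw [Cmd.den]
  set F : Cmd := .ite (.get 3 (.var 5))
    (.set 10 (.sub (.get 2 (.sub (.get 3 (.var 5)) (.const 1))) (.var 11)))
    (.set 10 (.const 1)) with hF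
  have hFv (y : ℕ) (hy : y ≠ 10) : (F.den s').var y = s'.var y :=
    Cmd.den_var _ _ (by simp [hF, Cmd.vars, hy])
  have hFa (a : ℕ) : (F.den s').arr a = s'.arr a := Cmd.den_arr _ _ (by simp [hF, Cmd.arrs])
  have hF10 : (F.den s').var 10 ≠ 0 ↔ S i := by
    rw [hS]
    by_cases hL : s.arr 3 i = 0
    · rw [hF, Cmd.den_ite_of_eq (by simpa only [Expr.eval, hi, ha3] using hL)]
      simp [Cmd.den, Expr.eval, hL]
    · rw [hF, Cmd.den_ite_of_ne (by simpa only [Expr.eval, hi, ha3] using hL)]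
      simp only [Cmd.den, Expr.eval, State.setVar_var, if_true, hi, ha3, ha2, hv11]
      omega
  generalize F.den s' = s1 at *
  have hHi : Expr.eval s1 (.sub (.get 2 (.var 5)) (.var 11)) ≠ 0 ↔ H i := by
    simp only [Expr.eval]
    rw [hH, hFa, ha2, hFv 5 (by decide), hi, hFv 11 (by decide), hv11]
    omega
  have hkeep (hSH : S i ↔ H i) : Classified S H (i + 1) ((keep.den s1).setVar 5 (i + 1)) := by
    refine hI.keep hSH ?_ ?_ ?_ <;> simp [RAM.keep, Cmd.den, Expr.eval, hFv, hFa, hi]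
  by_cases hSi : S i
  · rw [Cmd.den_ite_of_ne (e := .var 10) (hF10.2 hSi)]
    by_cases hHi' : H i
    · rw [Cmd.den_ite_of_ne (hHi.2 hHi')]
      exact hkeep (by tauto)
    · rw [Cmd.den_ite_of_eq (not_not.1 fun h => hHi' (hHi.1 h))]
      refine hI.skip (by tauto) ?_ ?_ ?_ <;> simp [Cmd.den, hHi', hFv, hFa]
  · rw [Cmd.den_ite_of_eq (e := .var 10) (not_not.1 fun h => hSi (hF10.1 h))]
    by_cases hHi' : H i
    · rw [Cmd.den_ite_of_ne (hHi.2 hHi')]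
      refine hI.skip (by tauto) ?_ ?_ ?_ <;> simp [Cmd.den, Expr.eval, hHi', hSi, hFv, hFa]
    · rw [Cmd.den_ite_of_eq (not_not.1 fun h => hHi' (hHi.1 h))]
      exact hkeep (by tauto)

end

/-- Induction over the iterations of a loop that fills a matrix, by rows. -/
theorem den_loop_loop {p : Cmd} {s : State} (Q : ℕ → ℕ → State → Prop) (hp : 5 ∉ p.vars)
    (hp' : 6 ∉ p.vars) (hp0 : 0 ∉ p.vars)
    (hstep : ∀ i < s.var 0, ∀ j < s.var 0, ∀ s' : State, s'.var 5 = i → s'.var 6 = j →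
      (∀ y, y ∉ 5 :: 6 :: p.vars → s'.var y = s.var y) → (∀ a, a ∉ p.arrs → s'.arr a = s.arr a) →
      Q i j (p.den s') ∧ ∀ a < s.var 0, ∀ b < s.var 0, Q a b s' → Q a b (p.den s'))
    (hQ : ∀ i j s' y, Q i j (s'.setVar 5 y) ↔ Q i j s')
    (hQ' : ∀ i j s' y, Q i j (s'.setVar 6 y) ↔ Q i j s') :
    ∀ i < s.var 0, ∀ j < s.var 0, Q i j ((Cmd.loop 5 0 (.loop 6 0 p)).den s) := by
  refine Cmd.den_loop (x := 5) (b := 0) (s := s) (p := .loop 6 0 p)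
    (fun i s' => ∀ a < i, ∀ b < s.var 0, Q a b s') (by simp [Cmd.vars, hp]) (by simp) ?_
  intro i hi s1 hi5 hv ha hI
  have hs1 : s1.var 0 = s.var 0 := hv 0 (by simp [Cmd.vars, hp0])
  have h := Cmd.den_loop (x := 6) (b := 0) (s := s1) (p := p)
    (fun j s' => (∀ a < i, ∀ b < s.var 0, Q a b s') ∧ ∀ b < j, Q i b s') hp' ?_ ?_
  · rw [hs1] at h
    intro a ha' b hb
    rw [hQ]
    rcases Nat.lt_succ_iff_lt_or_eq.1 ha' with ha' | rfl
    · exact h.1 a ha' b hb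
    · exact h.2 b hb
  · refine ⟨fun a ha' b hb => ?_, by simp⟩
    rw [hQ']
    exact hI a ha' b hb
  · rintro j hj s2 hj6 hv' ha' ⟨h1, h2⟩
    rw [hs1] at hj
    obtain ⟨h3, h4⟩ := hstep i hi j hj s2
      (by rw [hv' 5 (by simp [hp]), hi5]) hj6
      (fun y hy => by
        simp only [List.mem_cons, not_or] at hy
        rw [hv' y (by simp [hy]), hv y (by simp [Cmd.vars, hy])])
      (fun a hpa => by rw [ha' a hpa, ha a hpa])
    refine ⟨fun a hai b hb => ?_, fun b hb => ?_⟩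
    · rw [hQ']
      exact h4 a (hai.trans hi) b hb (h1 a hai b hb)
    · rw [hQ']
      rcases Nat.lt_succ_iff_lt_or_eq.1 hb with hb | rfl
      · exact h4 i hi b (hb.trans hj) (h2 b hb)
      · exact h3

theorem mul_add_injective {m i j a b : ℕ} (hj : j < m) (hb : b < m)
    (h : i * m + j = a * m + b) : i = a ∧ j = b := by
  have h1 : i = a := by
    rcases lt_trichotomy i a with hlt | heq | hlt
    · have := Nat.mul_le_mul_right m (Nat.succ_le_of_lt hlt)
      rw [Nat.succ_mul] at this
      omega
    · exact heq
    · have := Nat.mul_le_mul_right m (Nat.succ_le_of_lt hlt)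
      rw [Nat.succ_mul] at this
      omega
  subst h1
  exact ⟨rfl, by omega⟩

theorem gather_spec {n m : ℕ} {s : State} (h0 : s.var 0 = n) (h12 : s.var 12 = m)
    (h8 : ∀ u < n, s.arr 8 u = u * m) (hmn : m ≤ n) :
    ∀ i < m, ∀ j < m,
      (gather.den s).arr 7 (i * m + j) = s.arr 0 (s.arr 1 (s.arr 6 i) + s.arr 6 j) := by
  intro i hi j hj
  refine den_loop_loop (fun i j s' => i < m → j < m →
    s'.arr 7 (i * m + j) = s.arr 0 (s.arr 1 (s.arr 6 i) + s.arr 6 j)) (by decide) (by decide)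
    (by decide) ?_ (by simp) (by simp) i (by omega) j (by omega) hi hj
  intro i hi j hj s' h5 h6 hv ha
  rw [h0] at hi hj ⊢
  have hv12 : s'.var 12 = m := by rw [hv 12 (by decide), h12]
  have ha0 : s'.arr 0 = s.arr 0 := ha 0 (by decide)
  have ha1 : s'.arr 1 = s.arr 1 := ha 1 (by decide)
  have ha6 : s'.arr 6 = s.arr 6 := ha 6 (by decide)
  have ha8 : s'.arr 8 i = i * m := by rw [ha 8 (by decide), h8 i hi]
  simp only [Cmd.den, Expr.eval, h5, h6, hv12, ha0, ha1, ha6, ha8]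
  by_cases him : i < m
  · by_cases hjm : j < m
    -- Only pairs inside the `m × m` square are written, where the address `i * m + j` determines
    -- the pair; so no entry is overwritten by another.
    · rw [if_pos (by omega), if_pos (by omega)]
      simp only [State.setArr_arr, if_true]
      refine ⟨by simp, fun a _ b _ hQ ham hbm => ?_⟩
      rw [Function.update_apply]
      split_ifs with h
      · obtain ⟨rfl, rfl⟩ := mul_add_injective hbm hjm h
        rfl
      · exact hQ ham hbm
    · rw [if_pos (by omega), if_neg (by omega)]
      exact ⟨fun _ h => absurd h hjm, fun _ _ _ _ h => h⟩
  · rw [if_neg (by omega)]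
    exact ⟨fun h => absurd h him, fun _ _ _ _ h => h⟩

/-- For `j ≥ m` the addresses of different pairs may coincide, but a cell always receives the
content of the same cell of array `7`. -/
theorem copyBack_spec {n m : ℕ} {s : State} (h0 : s.var 0 = n) (h8 : ∀ u < n, s.arr 8 u = u * m) :
    ∀ i < n, ∀ j < n, (copyBack.den s).arr 0 (i * m + j) = s.arr 7 (i * m + j) := by
  intro i hi j hj
  refine den_loop_loop (fun i j s' => s'.arr 0 (i * m + j) = s.arr 7 (i * m + j)) (by decide)
    (by decide) (by decide) ?_ (by simp) (by simp) i (by omega) j (by omega)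
  intro i hi j hj s' h5 h6 hv ha
  rw [h0] at hi hj ⊢
  have ha7 : s'.arr 7 = s.arr 7 := ha 7 (by decide)
  have ha8 : s'.arr 8 i = i * m := by rw [ha 8 (by decide), h8 i hi]
  simp only [Cmd.den, Expr.eval, h5, h6, ha7, ha8, State.setArr_arr, if_true]
  refine ⟨by simp, fun a _ b _ hQ => ?_⟩
  rw [Function.update_apply]
  split_ifs with h
  · rw [h]
  · exact hQ

/-- The reduction, up to the choice of the output. -/
def reduce : Cmd :=
  .seq (mulTable 1 0) <| .seq auction <| .seq findGap <| .seq classify <|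
  .seq (mulTable 8 12) <| .seq gather copyBack

theorem reduce_wf : reduce.WF [0, 2] := by decide

/-- The reduced instance is the output if it is small. Otherwise, an instance with an empty graph
and the parameter `0` is the output. -/
def output : Cmd :=
  -- The test is `m + 3 > 3 * (k - h)` with truncated subtraction; it holds in particular when `k ≤
  -- h`.
  .ite (.sub (.add (.var 12) (.const 3)) (.add (.sub (.var 1) (.var 13))
      (.add (.sub (.var 1) (.var 13)) (.sub (.var 1) (.var 13)))))
    (.seq (.set 0 (.const 0)) (.set 1 (.const 0)))
    (.seq (.set 0 (.var 12)) (.set 1 (.sub (.var 1) (.var 13))))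

theorem output_wf : output.WF [] := by decide

/-- The kernelization. -/
def kernelize : Prog :=
  .seq (.set 2 (.add (.var 0) (.const 1))) (.seq reduce.toProg output.toProg)

end RAM

/-! ### Correctness of the kernelization -/

namespace GraphInstance

/-- The adjacency relation of the graph on all natural numbers. -/
def natAdj (I : GraphInstance) (u v : ℕ) : Prop :=
  ∃ (hu : u < I.n) (hv : v < I.n), I.G.Adj ⟨u, hu⟩ ⟨v, hv⟩

theorem natAdj_iff (I : GraphInstance) (u v : Fin I.n) : I.natAdj u v ↔ I.G.Adj u v :=
  ⟨fun ⟨_, _, h⟩ => h, fun h => ⟨u.2, v.2, h⟩⟩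

/-- The initial state, with the number of vertices plus one in register `2`. -/
noncomputable def startState (I : GraphInstance) : RAM.State :=
  I.initialState.setVar 2 (I.n + 1)

theorem startState_adj (I : GraphInstance) (u v : ℕ) (hu : u < I.n) (hv : v < I.n) :
    (I.natAdj u v → I.startState.arr 0 (u * I.n + v) = 1) ∧
      (¬ I.natAdj u v → I.startState.arr 0 (u * I.n + v) = 0) := by
  refine ⟨fun h => if_pos ⟨rfl, ⟨u, hu⟩, ⟨v, hv⟩, (I.natAdj_iff ⟨u, hu⟩ ⟨v, hv⟩).1 h, rfl⟩,
    fun h => if_neg ?_⟩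
  rintro ⟨-, i, j, hij, heq⟩
  obtain ⟨rfl, rfl⟩ := RAM.mul_add_injective hv j.2 heq
  exact h ((I.natAdj_iff i j).2 hij)

theorem startState_arr (I : GraphInstance) (a : ℕ) (ha : a ≠ 0) :
    I.startState.arr a = fun _ => 0 := by
  funext m
  exact if_neg fun h => ha h.1

/-- What the reduction computes. -/
theorem den_reduce (I : GraphInstance) {q : ℕ} (hq : 2 ≤ q) :
    ∃ (m h : ℕ) (e : Fin m → Fin I.n),
      (RAM.reduce.den I.startState).var 1 = I.k ∧ (RAM.reduce.den I.startState).var 12 = m ∧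
      (RAM.reduce.den I.startState).var 13 = h ∧
      (∀ i j : Fin m, (I.natAdj (e i) (e j) →
          (RAM.reduce.den I.startState).arr 0 (i * m + j) = 1) ∧
        (¬ I.natAdj (e i) (e j) → (RAM.reduce.den I.startState).arr 0 (i * m + j) = 0)) ∧
      ∃ c, c + h + m = I.n ∧
        indexCodingLength q I.G = c + indexCodingLength q (I.G.comap e) ∧
        3 * indexCodingLength q (I.G.comap e) ≤ 2 * m := by
  classical
  have hs1 : RAM.Static I.n I.natAdj ((RAM.mulTable 1 0).den I.startState) := by
    refine ⟨RAM.Cmd.den_var _ _ (by decide), RAM.Cmd.den_var _ _ (by decide),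
      fun u hu v hv => ?_⟩
    rw [RAM.mulTable_spec 1 0 (by decide) _ u hu, RAM.Cmd.den_arr _ _ (by decide)]
    exact I.startState_adj u v hu hv
  have hinv1 : RAM.Auction I.n I.natAdj ((RAM.mulTable 1 0).den I.startState) := by
    rw [RAM.Auction, RAM.Cmd.den_arr _ _ (by decide), RAM.Cmd.den_arr _ _ (by decide),
      RAM.Cmd.den_arr _ _ (by decide), I.startState_arr _ (by decide),
      I.startState_arr _ (by decide), I.startState_arr _ (by decide)]
    constructor <;> simp
  obtain ⟨hinv2, hfin2⟩ := RAM.auction_spec hs1 hinv1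
  have hs2 := hs1.den RAM.auction (by decide) (by decide)
  have hk2 : (RAM.auction.den ((RAM.mulTable 1 0).den I.startState)).var 1 = I.k := by
    rw [RAM.Cmd.den_var _ _ (by decide), RAM.Cmd.den_var _ _ (by decide)]
    rfl
  rw [RAM.reduce, RAM.Cmd.den, RAM.Cmd.den]
  generalize RAM.auction.den ((RAM.mulTable 1 0).den I.startState) = s2 at *
  obtain ⟨hj, hgap⟩ := RAM.findGap_spec hs2.var_zero hs2.var_two
  obtain ⟨hS, hH, hL⟩ := AuctionInv.crown hinv2 hfin2 hj hgap
  have hs3 := hs2.den RAM.findGap (by decide) (by decide)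
  have ha3 (a : ℕ) : (RAM.findGap.den s2).arr a = s2.arr a :=
    RAM.Cmd.den_arr _ _ (by simp [RAM.findGap, RAM.findLevel, RAM.Cmd.arrs])
  have hk3 : (RAM.findGap.den s2).var 1 = I.k := by rw [RAM.Cmd.den_var _ _ (by decide), hk2]
  rw [RAM.Cmd.den]
  generalize RAM.findGap.den s2 = s3 at *
  have hcl := RAM.classify_spec (s := s3) (fun _ => Iff.rfl) (fun _ => Iff.rfl)
  rw [hs3.var_zero] at hcl
  simp only [ha3] at hcl
  have hs4 := hs3.den RAM.classify (by decide) (by decide)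
  have hk4 : (RAM.classify.den s3).var 1 = I.k := by rw [RAM.Cmd.den_var _ _ (by decide), hk3]
  rw [RAM.Cmd.den]
  generalize RAM.classify.den s3 = s4 at *
  obtain ⟨hhead, hmem, hsurj, hlt⟩ := hcl
  have hinj : ∀ t < s4.var 12, ∀ t' < s4.var 12, s4.arr 6 t = s4.arr 6 t' → t = t' := by
    intro t ht t' ht' heq
    rcases lt_trichotomy t t' with h | h | h
    · have := hlt t' ht' t h
      omega
    · exact h
    · have := hlt t ht t' h
      omega
  let e : Fin (s4.var 12) → Fin I.n := fun t => ⟨s4.arr 6 t, (hmem t t.2).1⟩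
  have he : Function.Injective e := fun t t' h =>
    Fin.ext (hinj t t.2 t' t'.2 (congrArg Fin.val h))
  have hmn : s4.var 12 ≤ I.n := by simpa using Fintype.card_le_of_injective e he
  have h8 := RAM.mulTable_spec 8 12 (by decide) s4
  rw [hs4.var_zero] at h8
  have hs5 := hs4.den (RAM.mulTable 8 12) (by decide) (by decide)
  have hv5 (x : ℕ) (hx : x ≠ 5 ∧ x ≠ 14) : ((RAM.mulTable 8 12).den s4).var x = s4.var x :=
    RAM.Cmd.den_var _ _ (by simp [RAM.mulTable, RAM.Cmd.vars, hx])
  have h65 : ((RAM.mulTable 8 12).den s4).arr 6 = s4.arr 6 := RAM.Cmd.den_arr _ _ (by decide)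
  rw [RAM.Cmd.den]
  generalize (RAM.mulTable 8 12).den s4 = s5 at *
  have hg := RAM.gather_spec hs5.var_zero (hv5 12 (by decide)) h8 hmn
  rw [RAM.Cmd.den]
  have h86 : (RAM.gather.den s5).arr 8 = s5.arr 8 := RAM.Cmd.den_arr _ _ (by decide)
  have hc := RAM.copyBack_spec (s := RAM.gather.den s5) (m := s4.var 12)
    ((hs5.den RAM.gather (by decide) ⟨by decide, by decide⟩).var_zero) (by rw [h86]; exact h8)
  refine ⟨s4.var 12, s4.var 13, e, ?_, ?_, ?_, ?_, ?_⟩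
  · rw [RAM.Cmd.den_var _ _ (by decide), RAM.Cmd.den_var _ _ (by decide), hv5 1 (by decide), hk4]
  · rw [RAM.Cmd.den_var _ _ (by decide), RAM.Cmd.den_var _ _ (by decide), hv5 12 (by decide)]
  · rw [RAM.Cmd.den_var _ _ (by decide), RAM.Cmd.den_var _ _ (by decide), hv5 13 (by decide)]
  · intro i j
    rw [hc i (by omega) j (by omega), hg i i.2 j j.2, h65]
    exact hs5.adj _ (e i).2 _ (e j).2
  · set jg := s3.var 11
    let S : Finset (Fin I.n) :=
      {u | s2.arr 3 u = 0 ∨ jg < s2.arr 2 (s2.arr 3 u - 1)}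
    let H : Finset (Fin I.n) := {v | jg < s2.arr 2 v}
    have hmS (u : Fin I.n) : u ∈ S ↔ s2.arr 3 u = 0 ∨ jg < s2.arr 2 (s2.arr 3 u - 1) := by
      simp [S]
    have hmH (v : Fin I.n) : v ∈ H ↔ jg < s2.arr 2 v := by simp [H]
    -- `f` reads the owner of a right copy and `g` the partner of a left copy; the default values
    -- never occur on `H` and outside of `S`, respectively.
    let f : Fin I.n → Fin I.n := fun v =>
      if hv : s2.arr 4 v - 1 < I.n then ⟨s2.arr 4 v - 1, hv⟩ else v
    let g : Fin I.n → Fin I.n := fun u =>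
      if hu : s2.arr 3 u - 1 < I.n then ⟨s2.arr 3 u - 1, hu⟩ else u
    have hf (v : Fin I.n) (hv : v ∈ H) : (f v : ℕ) = s2.arr 4 v - 1 := by
      simp [f, (hH v v.2 ((hmH v).1 hv)).1]
    have hnS (u : Fin I.n) (hu : u ∉ S) : s2.arr 3 u ≠ 0 := fun h => hu ((hmS u).2 (.inl h))
    have hg (u : Fin I.n) (hu : u ∉ S) : (g u : ℕ) = s2.arr 3 u - 1 := by
      simp [g, (hL u u.2 (hnS u hu)).1]
    have key := indexCodingLength_of_matching hq I.G S H f g ?_ ?_ ?_ ?_ ?_ ?_ ?_ e he ?_ ?_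
    · refine ⟨(S \ H).card, ?_, key.1, key.2.1⟩
      have hcard : s4.var 13 = (H \ S).card := by
        rw [hhead, ← Finset.card_map Fin.valEmbedding]
        congr 1
        ext u
        simp only [Finset.mem_filter, Finset.mem_range, Finset.mem_map, Finset.mem_sdiff, hmS, hmH,
          Fin.valEmbedding_apply]
        exact ⟨fun h => ⟨⟨u, h.1⟩, h.2, rfl⟩, by rintro ⟨v, h, rfl⟩; exact ⟨v.2, h⟩⟩
      have := key.2.2
      omega
    · intro u hu v huv
      exact (hmH v).2 (hS u u.2 ((hmS u).1 hu) v v.2 ((I.natAdj_iff u v).2 huv))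
    · intro v hv
      rw [hmS, hf v hv]
      exact .inr (hH v v.2 ((hmH v).1 hv)).2.1
    · intro v hv
      have h := (hH v v.2 ((hmH v).1 hv)).2.2.1
      rw [← hf v hv, natAdj_iff] at h
      exact h.symm
    · intro v hv w hw hvw
      have h1 := (hH v v.2 ((hmH v).1 hv)).2.2.2
      have h2 := (hH w w.2 ((hmH w).1 hw)).2.2.2
      rw [← hf v hv, hvw, hf w hw, h2] at h1
      exact Fin.ext (by omega)
    · intro u hu h
      rw [hmH, hg u hu] at h
      exact hu ((hmS u).2 (.inr h))
    · intro u hu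
      have h := (hL u u.2 (hnS u hu)).2.1
      rwa [← hg u hu, natAdj_iff] at h
    · intro u hu v hv huv
      have h1 := (hL u u.2 (hnS u hu)).2.2
      have h2 := (hL v v.2 (hnS v hv)).2.2
      rw [← hg u hu, huv, hg v hv, h2] at h1
      exact Fin.ext (by omega)
    · intro z
      rw [hmS, hmH]
      exact (hmem z z.2).2
    · intro v hv
      rw [hmS, hmH] at hv
      obtain ⟨t, ht, htv⟩ := hsurj v v.2 hv
      exact ⟨⟨t, ht⟩, Fin.ext htv⟩

/-- The kernelization outputs an equivalent small instance. -/
theorem exists_run_kernelize {q : ℕ} (hq : 2 ≤ q) (I : GraphInstance) :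
    ∃ J : GraphInstance, (∃ (t : ℕ) (s : RAM.State), RAM.Run RAM.kernelize I.initialState t s ∧
        J.IsStoredIn s ∧ t ≤ ((RAM.reduce.cost + RAM.output.cost + .C 4).comp (.X + .C 1)).eval
          I.size) ∧
      (I ∈ DualIndexCoding q ↔ J ∈ DualIndexCoding q) ∧
      (J.n : ℤ) ≤ max (3 * (J.k : ℤ) - 3) 0 ∧ J.k ≤ I.k := by
  classical
  obtain ⟨m, h, e, h1, h12, h13, hadj, c, hcard, hind, hle⟩ := I.den_reduce hq
  have hn : I.n ≤ I.size := by
    rw [size, sq]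
    exact (Nat.le_mul_self I.n).trans (Nat.le_add_right _ _)
  -- The loops have lengths `n` and `n + 1`, hence the bound `I.size + 1`, and `X + 1` in the
  -- polynomial.
  obtain ⟨t, ht, hrun⟩ := RAM.Cmd.run_toProg [0, 2] (I.size + 1) RAM.reduce RAM.reduce_wf
    I.startState (by
      simp only [List.mem_cons, List.not_mem_nil, or_false, forall_eq_or_imp, forall_eq]
      exact ⟨Nat.le_succ_of_le hn, Nat.succ_le_succ hn⟩)
  set s := RAM.reduce.den I.startState
  obtain ⟨t', ht', hrun'⟩ := RAM.Cmd.run_toProg [] (I.size + 1) RAM.output RAM.output_wf s (by simp)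
  have hrun0 : RAM.Run (.set 2 (.add (.var 0) (.const 1))) I.initialState 4 I.startState :=
    RAM.Run.set _ _ _
  have hrun'' : ∃ (t : ℕ), RAM.Run RAM.kernelize I.initialState t (RAM.output.den s) ∧
      t ≤ ((RAM.reduce.cost + RAM.output.cost + .C 4).comp (.X + .C 1)).eval I.size := by
    refine ⟨4 + (t + t'), .seq hrun0 (.seq hrun hrun'), ?_⟩
    simp only [Polynomial.eval_comp, Polynomial.eval_add, Polynomial.eval_X, Polynomial.eval_C]
    omega
  obtain ⟨t, hrun, ht⟩ := hrun''
  simp only [DualIndexCoding, Set.mem_ofPred_eq]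
  -- The input asks whether the reduced graph saves `k - h` symbols. If `m ≥ 3 * (k - h) - 2`, it
  -- does: it saves at least `m / 3`, rounded up. Otherwise `m` satisfies the required bound.
  by_cases hsmall : m + 3 ≤ 3 * (I.k - h)
  · have hout : RAM.output.den s = (s.setVar 0 m).setVar 1 (I.k - h) := by
      rw [RAM.output, RAM.Cmd.den_ite_of_eq]
      · simp [RAM.Cmd.den, RAM.Expr.eval, h1, h12, h13]
      · simp only [RAM.Expr.eval, h1, h12, h13]
        omega
    refine ⟨⟨m, I.G.comap e, I.k - h⟩, ⟨t, _, hrun, ?_, ht⟩, ?_, ?_, Nat.sub_le _ _⟩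
    · rw [hout]
      refine ⟨by simp, by simp, fun i j => ?_⟩
      have h2 := hadj i j
      rw [natAdj_iff] at h2
      simp only [RAM.State.setVar_arr, SimpleGraph.comap_adj]
      split_ifs with h3
      · exact h2.1 h3
      · exact h2.2 h3
    · simp only
      omega
    · simp only
      omega
  · have hout : RAM.output.den s = (s.setVar 0 0).setVar 1 0 := by
      rw [RAM.output, RAM.Cmd.den_ite_of_ne]
      · simp [RAM.Cmd.den, RAM.Expr.eval]
      · simp only [RAM.Expr.eval, h1, h12, h13]
        omega
    refine ⟨⟨0, ⊥, 0⟩, ⟨t, _, hrun, ?_, ht⟩, ?_, by simp, Nat.zero_le _⟩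
    · rw [hout]
      exact ⟨by simp, by simp, fun i => i.elim0⟩
    · have h0 := indexCodingLength_le (exists_isIndexCode q (⊥ : SimpleGraph (Fin 0)))
      simp only
      omega

end GraphInstance

theorem theorem1p2 (q : ℕ) (hq : 2 ≤ q) :
    ∃ f : GraphInstance → GraphInstance,
      IsKernelization (DualIndexCoding q) f ∧
      ∀ I : GraphInstance,
        ((f I).n : ℤ) ≤ max (3 * ((f I).k : ℤ) - 3) 0 ∧ (f I).k ≤ I.k := by
  choose f hrun hiff hn hk using GraphInstance.exists_run_kernelize hq
  -- At most `3 * k` vertices give `9 * (k * k)` matrix bits, and the new parameter has at most `k`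
  -- bits.
  refine ⟨f, ⟨⟨_, _, hrun⟩, hiff, fun k => 9 * (k * k) + k, ?_, fun I => ?_⟩,
    fun I => ⟨hn I, hk I⟩⟩
  · exact (Primrec.nat_add.comp (Primrec.nat_mul.comp (Primrec.const 9)
      (Primrec.nat_mul.comp Primrec.id Primrec.id)) Primrec.id).to_comp
  · beta_reduce
    have h1 : (f I).n ≤ 3 * I.k := by
      have := hn I
      have := hk I
      omega
    have h2 : (f I).k.size ≤ (f I).k := Nat.size_le.2 Nat.lt_two_pow_self
    have h3 := Nat.mul_le_mul h1 h1
    have h4 := hk I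
    refine ⟨?_, by omega⟩
    rw [GraphInstance.size, sq]
    have h5 : 3 * I.k * (3 * I.k) = 9 * (I.k * I.k) := by ring
    omega
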